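/- Let $\lambda>0$ and $c_\lambda^{-1}=2^{\lambda+1/2}\Gamma(\lambda+\tfrac12)$. Put $$j_\alpha(z)=\Gamma(\alpha+1)\sum_{n\ge 0}\frac{(-1)^n(z/2)^{2n}}{n!\,\Gamma(n+\alpha+1)},\qquad E_\lambda(iz)=j_{\lambda-1/2}(z)+\frac{iz}{2\lambda+1}\,j_{\lambda+1/2}(z),$$ $$(\mathcal F_\lambda f)(\xi)=c_\lambda\int_{\mathbb R} f(x)E_\lambda(-ix\xi)|x|^{2\lambda}\,dx,\qquad \tau_y f(x)=c_\lambda\int_{\mathbb R}(\mathcal F_\lambda f)(\xi)E_\lambda(ix\xi)E_\lambda(iy\xi)|\xi|^{2\lambda}\,d\xi,$$ $$(f*_\lambda g)(x)=c_\lambda\int_{\mathbb R} f(t)\,(\tau_x g)(-t)\,|t|^{2\lambda}\,dt,\qquad P_y(x)=\frac{2^{\lambda+1/2}\Gamma(\lambda+1)}{\sqrt\pi}\,\frac{y}{(x^2+y^2)^{\lambda+1}}\quad(y>0).$$ Let $0<p\le 1$, let $A>0$ and let $\kappa\ge 0$ be an integer. A Lebesgue measurable function $a:\mathbb R\to\mathbb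 C$ is called a $p_\lambda$-atom of vanishing order $\kappa$ with constant $A$ if $\kappa\ge 2\left[(2\lambda+1)\frac{1-p}{p}\right]$ (where $[\cdot]$ is the integer part) and there are $x_0\in\mathbb R$ and $0<\delta_0<|x_0/2|$ such that, with $I(x_0,\delta_0)=\{x:|x-x_0|<\delta_0\}$ and $|I(x_0,\delta_0)|_\lambda=\int_{I(x_0,\delta_0)}|x|^{2\lambda}\,dx$, 1. $\|a\|_{L^\infty}\le A\,|I(x_0,\delta_0)|_\lambda^{-1/p}$; 2. $a=0$ almost everywhere outside $I(x_0,\delta_0)$; 3. $\int_{\mathbb R}t^k a(t)|t|^{2\lambda}\,dt=0$ for $k=0,1,\dots,\kappa$. **Theorem.** Let $\lambda>0$ and $\frac{2\lambda}{2\lambda+1}<p\le 1$. There is a constant $C>0$, depending only on $\lambda$ and $p$, such that for every $A>0$, every integer $\kappa$, every $p_\lambda$-atom $a$ of vanishing order $\kappa$ with constant $A$, and every $y>0$, the function $|(a*_\lambda P_y)(x)|^p|x|^{2\lambda}$ is integrable on $\mathbb R$ and $$\int_{\mathbb R}|(a*_\lambda P_y)(x)|^p\,|x|^{2\lambda}\,dx\le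 C A^p .$$ -/

import Mathlib

namespace DunklHardy

/-- The normalizing constant `c_lam = (2 ^ (lam + 1/2) * Γ(lam + 1/2))⁻¹`. -/
noncomputable def cConst (lam : ℝ) : ℝ :=
  ((2 : ℝ) ^ (lam + 1 / 2) * Real.Gamma (lam + 1 / 2))⁻¹

/-- The density `|x| ^ (2 lam)` of the Dunkl measure on the line. -/
noncomputable def weight (lam x : ℝ) : ℝ := |x| ^ (2 * lam)

/-- The normalized Bessel function
`j_α(z) = Γ(α + 1) ∑ₙ (-1)ⁿ (z / 2) ^ (2 n) / (n! Γ(n + α + 1))`. -/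
noncomputable def normBessel (α : ℝ) (z : ℂ) : ℂ :=
  (Real.Gamma (α + 1) : ℂ) *
    ∑' n : ℕ, (-1 : ℂ) ^ n * (z / 2) ^ (2 * n) /
      ((n.factorial : ℂ) * (Real.Gamma (n + α + 1) : ℂ))

/-- The Dunkl kernel `E_lam`, given by
`E_lam(i z) = j_{lam - 1/2}(z) + (i z / (2 lam + 1)) j_{lam + 1/2}(z)`; below `w = i z`,
that is `z = -i w`. -/
noncomputable def dunklKernel (lam : ℝ) (w : ℂ) : ℂ :=
  normBessel (lam - 1 / 2) (-Complex.I * w) +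
    w / (2 * lam + 1 : ℝ) * normBessel (lam + 1 / 2) (-Complex.I * w)

/-- The Dunkl transform `(F_lam f)(ξ) = c_lam ∫ f(x) E_lam(-i x ξ) |x| ^ (2 lam) dx`. -/
noncomputable def dunklTransform (lam : ℝ) (f : ℝ → ℂ) (ξ : ℝ) : ℂ :=
  (cConst lam : ℂ) *
    ∫ x : ℝ, f x * dunklKernel lam (-Complex.I * x * ξ) * (weight lam x : ℂ)

/-- The Dunkl translation
`(τ_y f)(x) = c_lam ∫ (F_lam f)(ξ) E_lam(i x ξ) E_lam(i y ξ) |ξ| ^ (2 lam) dξ`. -/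
noncomputable def dunklTranslation (lam y : ℝ) (f : ℝ → ℂ) (x : ℝ) : ℂ :=
  (cConst lam : ℂ) *
    ∫ ξ : ℝ, dunklTransform lam f ξ * dunklKernel lam (Complex.I * x * ξ) *
      dunklKernel lam (Complex.I * y * ξ) * (weight lam ξ : ℂ)

/-- The Dunkl convolution `(f ∗ g)(x) = c_lam ∫ f(t) (τ_x g)(-t) |t| ^ (2 lam) dt`. -/
noncomputable def dunklConv (lam : ℝ) (f g : ℝ → ℂ) (x : ℝ) : ℂ :=
  (cConst lam : ℂ) *
    ∫ t : ℝ, f t * dunklTranslation lam x g (-t) * (weight lam t : ℂ)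

/-- The Poisson kernel
`P_y(x) = 2 ^ (lam + 1/2) Γ(lam + 1) π ^ (-1/2) y / (x² + y²) ^ (lam + 1)`,
whose Dunkl transform is `exp (-y |ξ|)`. -/
noncomputable def poissonKernel (lam y : ℝ) (x : ℝ) : ℂ :=
  (((2 : ℝ) ^ (lam + 1 / 2) * Real.Gamma (lam + 1) / Real.sqrt Real.pi *
    (y / (x ^ 2 + y ^ 2) ^ (lam + 1)) : ℝ) : ℂ)

/-- The Poisson integral `(a ∗ P_y)(x)`. -/
noncomputable def poissonIntegral (lam : ℝ) (a : ℝ → ℂ) (y x : ℝ) : ℂ :=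
  dunklConv lam a (poissonKernel lam y) x

/-- The measure `|I(x₀, δ₀)|_lam = ∫_{|x - x₀| < δ₀} |x| ^ (2 lam) dx` of an interval. -/
noncomputable def intervalMass (lam x₀ δ₀ : ℝ) : ℝ :=
  ∫ x in Metric.ball x₀ δ₀, weight lam x

/-- `a` is an atom for the exponents `lam` and `p` with vanishing order `κ`, where `A` is the
constant in the size condition. As usual for elements of `L^∞`, the support is understood up
to null sets. -/
def IsAtom (lam p A : ℝ) (κ : ℕ) (a : ℝ → ℂ) : Prop :=
  AEMeasurable a MeasureTheory.volume ∧
  2 * ⌊(2 * lam + 1) * ((1 - p) / p)⌋ ≤ (κ : ℤ) ∧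
  ∃ x₀ δ₀ : ℝ, 0 < δ₀ ∧ δ₀ < |x₀ / 2| ∧
    MeasureTheory.eLpNorm a ⊤ MeasureTheory.volume ≤
      ENNReal.ofReal (A / intervalMass lam x₀ δ₀ ^ (1 / p)) ∧
    (∀ᵐ x : ℝ, x ∉ Metric.ball x₀ δ₀ → a x = 0) ∧
    ∀ k : ℕ, k ≤ κ → ∫ t : ℝ, (t : ℂ) ^ k * a t * (weight lam t : ℂ) = 0

end DunklHardy

namespace DunklHardy

open MeasureTheory Set

/-! The first half makes the kernel explicit: up to a positive constant, `τ_x P_y(-t)` is `y *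
poissonDensity lam y x t`, an average of `q ^ (-(lam + 1))` with `q = y² + x² + t² - 2xts` over `s ∈
(-1, 1)` (`dunklTranslation_poissonKernel`). By the Gamma integral `P_y` is a superposition of
Gaussians. Weber's formula integrates a Gaussian against two Dunkl kernels and returns a Gaussian
times `E_lam` at a real argument. Writing that `E_lam` as an average of exponentials and integrating
out the Gaussian parameter leaves the power of `q`.

The second half is the atomic estimate. Put `D = ||x| - |x₀||` and let `N` be the integer part of
`(2 lam + 1)(1 - p)/p`. Near `±x₀` the Poisson integral is bounded by the sup norm of `a`, because
kernel times weight is dominated by two Cauchy kernels. Far away, `q` is quadratic in `t`, so a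
Taylor polynomial of order `N` in the relative increment of `q` has degree `2N` in `t`. The moments
of `a` remove it, and a gain `(δ/D)^(N+1)` remains. The mass of the interval and the kernel's own
decay give one more factor `δ/D`, and also `(|x₀|/(|x| + |x₀|))^(2 lam)`; this is
`norm_integral_mul_poissonDensity_le_decay`.

Raising to the power `p` and absorbing the weight yields `|x₀|^(2 lam) (1 + D/δ)^(-σ)` with `σ =
(N+2)p - 2 lam (1-p)`, and `σ > 1` by the choice of `N`. The integral of this is of order `δ |x₀|^(2
lam)`, comparable to the mass of the interval, which the normalization of the atom cancels. -/

/-! ### Rising factorials and the series `₀F₁` -/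

/-- The rising factorial `(β)ₙ = β (β + 1) ⋯ (β + n - 1)`. -/
noncomputable def poch (β : ℝ) (n : ℕ) : ℝ := (ascPochhammer ℝ n).eval β

@[simp] lemma poch_zero (β : ℝ) : poch β 0 = 1 := by simp [poch]

lemma poch_succ (β : ℝ) (n : ℕ) : poch β (n + 1) = poch β n * (β + n) := by
  simp [poch, ascPochhammer_succ_eval]

lemma poch_pos {β : ℝ} (hβ : 0 < β) (n : ℕ) : 0 < poch β n := ascPochhammer_pos n β hβ

lemma poch_add (β : ℝ) (m n : ℕ) : poch β (m + n) = poch β m * poch (β + m) n := by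
  induction n with
  | zero => simp
  | succ n ih => rw [← add_assoc, poch_succ, ih, poch_succ]; push_cast; ring

lemma poch_succ_left (β : ℝ) (n : ℕ) : poch β (n + 1) = β * poch (β + 1) n := by
  have h := poch_add β 1 n
  have h1 : poch β 1 = β := by simpa using poch_succ β 0
  rw [add_comm, h, h1]; simp

lemma Gamma_add_nat {β : ℝ} (hβ : 0 < β) (n : ℕ) :
    Real.Gamma (β + n) = poch β n * Real.Gamma β := by
  induction n with
  | zero => simp
  | succ n ih =>
    rw [Nat.cast_succ, ← add_assoc, Real.Gamma_add_one (by positivity), ih, poch_succ]; ring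

/-- All factors after the first are at least `1`. This lower bound, uniform in `n`, lets the
exponential series dominate `₀F₁`. -/
lemma min_one_le_poch {β : ℝ} (hβ : 0 < β) (n : ℕ) : min 1 β ≤ poch β n := by
  rcases n with _ | n
  · simp
  · refine (min_le_right _ _).trans ?_
    induction n with
    | zero => simp [poch_succ]
    | succ n ih =>
      rw [poch_succ]
      refine ih.trans (le_mul_of_one_le_right (poch_pos hβ _).le ?_)
      push_cast
      linarith [(Nat.cast_nonneg n : (0 : ℝ) ≤ n)]

/-- The Vandermonde identity for rising factorials. -/
lemma sum_choose_descFactorial_poch (n : ℕ) : ∀ (m : ℕ) (β : ℝ),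
    ∑ ij ∈ Finset.HasAntidiagonal.antidiagonal n,
      (n.choose ij.1 : ℝ) * (m.descFactorial ij.1 * poch (β + ij.1) ij.2) = poch (β + m) n := by
  induction n with
  | zero => intro m β; simp
  | succ n ih =>
    intro m β
    rw [Finset.sum_antidiagonal_choose_succ_mul
      (fun i j : ℕ => (m.descFactorial i : ℝ) * poch (β + i) j) n]
    have h1 : ∑ ij ∈ Finset.HasAntidiagonal.antidiagonal n,
        (n.choose ij.1 : ℝ) * (m.descFactorial ij.1 * poch (β + ij.1) (ij.2 + 1)) =
        (β + n) * poch (β + m) n := by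
      rw [← ih m β, Finset.mul_sum]
      refine Finset.sum_congr rfl fun ij hij => ?_
      have : (n : ℝ) = ij.1 + ij.2 := by exact_mod_cast (Finset.HasAntidiagonal.mem_antidiagonal.1 hij).symm
      rw [poch_succ, this]; ring
    have h2 : ∑ ij ∈ Finset.HasAntidiagonal.antidiagonal n,
        (n.choose ij.2 : ℝ) * (m.descFactorial (ij.1 + 1) * poch (β + (ij.1 + 1 : ℕ)) ij.2) =
        m * poch (β + m) n := by
      rcases m with _ | m
      · simp
      · have h := ih m (β + 1)
        rw [show β + ((m + 1 : ℕ) : ℝ) = β + 1 + m by push_cast; ring, ← h, Finset.mul_sum]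
        refine Finset.sum_congr rfl fun ij hij => ?_
        rw [Nat.succ_descFactorial_succ, ← Nat.choose_symm_of_eq_add
          (Finset.HasAntidiagonal.mem_antidiagonal.1 hij).symm]
        push_cast
        rw [show β + (ij.1 + 1 : ℝ) = β + 1 + ij.1 by ring]; ring
    rw [h1, h2, poch_succ]; ring

/-- The confluent limit function `₀F₁(β; v) = ∑ₖ vᵏ / (k! (β)ₖ)`. -/
noncomputable def hyp (β v : ℝ) : ℝ := ∑' k : ℕ, v ^ k / (k.factorial * poch β k)

lemma summable_hyp {β : ℝ} (hβ : 0 < β) (v : ℝ) :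
    Summable fun k : ℕ => v ^ k / (k.factorial * poch β k) := by
  have hm : 0 < min 1 β := lt_min one_pos hβ
  refine Summable.of_norm_bounded ((Real.summable_pow_div_factorial |v|).mul_left (min 1 β)⁻¹)
    fun k => ?_
  have h1 := poch_pos hβ k
  rw [norm_div, norm_pow, Real.norm_eq_abs, Real.norm_of_nonneg (by positivity),
    inv_mul_eq_div, div_div]
  gcongr
  exact min_one_le_poch hβ k

lemma hasSum_hyp {β : ℝ} (hβ : 0 < β) (v : ℝ) :
    HasSum (fun k : ℕ => v ^ k / (k.factorial * poch β k)) (hyp β v) :=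
  (summable_hyp hβ v).hasSum

lemma hyp_zero (β : ℝ) : hyp β 0 = 1 := by
  rw [hyp, tsum_eq_single 0]
  · simp
  · intro k hk; simp [hk]

/-! ### A double series and Weber's integral -/

lemma hasSum_exp_mul_exp_mul_hyp {β : ℝ} (hβ : 0 < β) (X T : ℝ) :
    HasSum (fun i : (ℕ × ℕ) × ℕ => X ^ i.1.1 / i.1.1.factorial * (T ^ i.1.2 / i.1.2.factorial) *
      ((X * T) ^ i.2 / (i.2.factorial * poch β i.2)))
      (Real.exp X * Real.exp T * hyp β (X * T)) := by
  have e (z : ℝ) : HasSum (fun n : ℕ => z ^ n / n.factorial) (Real.exp z) := by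
    rw [Real.exp_eq_exp_ℝ]; exact NormedSpace.expSeries_div_hasSum_exp z
  have h1 := summable_mul_of_summable_norm (e X).summable.norm (e T).summable.norm
  have h2 := summable_mul_of_summable_norm h1.norm (hasSum_hyp hβ (X * T)).summable.norm
  exact ((e X).mul (e T) h1).mul (hasSum_hyp hβ (X * T)) h2

/-- Since `(β)_{m+n} = (β)_m (β+m)_n`, this is Vandermonde's identity for `(β+m)_n` divided by
factorials. The terms with `k > m` drop out because the descending factorial vanishes there. -/
lemma doubleSeries_coeff {β : ℝ} (hβ : 0 < β) (X T : ℝ) (n m : ℕ) :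
    ∑ k ∈ Finset.range (n + 1), (if k ≤ n ∧ k ≤ m then
      X ^ (n - k) / (n - k).factorial * (T ^ (m - k) / (m - k).factorial) *
        ((X * T) ^ k / (k.factorial * poch β k)) else 0) =
    X ^ n * T ^ m * poch β (n + m) /
      (n.factorial * m.factorial * (poch β n * poch β m)) := by
  have hn := poch_pos hβ n
  have hm := poch_pos hβ m
  rw [add_comm n m, poch_add, ← sum_choose_descFactorial_poch n m β,
    Finset.Nat.sum_antidiagonal_eq_sum_range_succ_mk, Finset.mul_sum, Finset.mul_sum,
    Finset.sum_div]
  refine Finset.sum_congr rfl fun k hk => ?_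
  have hkn : k ≤ n := Nat.lt_succ_iff.1 (Finset.mem_range.1 hk)
  by_cases hkm : k ≤ m
  · rw [if_pos ⟨hkn, hkm⟩]
    obtain ⟨a, rfl⟩ := Nat.exists_eq_add_of_le hkn
    obtain ⟨b, rfl⟩ := Nat.exists_eq_add_of_le hkm
    have h1 : (((k + a).choose k : ℕ) : ℝ) = (k + a).factorial / (k.factorial * a.factorial) := by
      rw [Nat.cast_choose ℝ (Nat.le_add_right k a)]; simp
    have h2 : (((k + b).descFactorial k : ℕ) : ℝ) = (k + b).factorial / b.factorial := by
      rw [eq_div_iff (by positivity), mul_comm]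
      have := Nat.factorial_mul_descFactorial (Nat.le_add_right k b)
      rw [Nat.add_sub_cancel_left] at this
      exact_mod_cast this
    have hk := poch_pos hβ k
    have hka : 0 < poch (β + k) a := poch_pos (by positivity) a
    simp only [Nat.add_sub_cancel_left]
    rw [h1, h2, poch_add β k a]
    field_simp
    ring
  · rw [if_neg (fun h => hkm h.2), Nat.descFactorial_eq_zero_iff_lt.2 (not_le.1 hkm)]
    simp

/-- Rearrangement of the absolutely convergent triple product: the term with exponents `a`, `b`, `k`
is moved to the monomial `X^(a+k) T^(b+k)`, and the sum over `k` is done first. The left side is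
what termwise integration produces in Weber's formula. -/
lemma hasSum_doubleSeries {β : ℝ} (hβ : 0 < β) (X T : ℝ) :
    HasSum (fun i : ℕ × ℕ => X ^ i.1 * T ^ i.2 * poch β (i.1 + i.2) /
      (i.1.factorial * i.2.factorial * (poch β i.1 * poch β i.2)))
      (Real.exp X * Real.exp T * hyp β (X * T)) := by
  let G : (ℕ × ℕ) × ℕ → ℝ := fun i => if i.2 ≤ i.1.1 ∧ i.2 ≤ i.1.2 then
      X ^ (i.1.1 - i.2) / (i.1.1 - i.2).factorial *
        (T ^ (i.1.2 - i.2) / (i.1.2 - i.2).factorial) *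
        ((X * T) ^ i.2 / (i.2.factorial * poch β i.2)) else 0
  let e : (ℕ × ℕ) × ℕ → (ℕ × ℕ) × ℕ := fun i => ((i.1.1 + i.2, i.1.2 + i.2), i.2)
  have he : Function.Injective e := by
    rintro ⟨⟨a, b⟩, k⟩ ⟨⟨a', b'⟩, k'⟩ h
    simp only [e, Prod.mk.injEq] at h ⊢
    omega
  have hG : HasSum G (Real.exp X * Real.exp T * hyp β (X * T)) := by
    refine (he.hasSum_iff ?_).1 ?_
    · rintro ⟨⟨n, m⟩, k⟩ h
      refine if_neg fun hk => h ⟨((n - k, m - k), k), ?_⟩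
      have h1 : k ≤ n := hk.1
      have h2 : k ≤ m := hk.2
      simp [e, h1, h2]
    · convert hasSum_exp_mul_exp_mul_hyp hβ X T using 2 with i
      simp [G, e]
  refine hG.prod_fiberwise fun i => ?_
  rw [← doubleSeries_coeff hβ X T i.1 i.2]
  refine hasSum_sum_of_ne_finset_zero fun k hk => if_neg fun h => hk ?_
  exact Finset.mem_range.2 (Nat.lt_succ_iff.2 h.1)

lemma integral_rpow_add_mul_exp_neg_mul_sq {β b : ℝ} (hβ : 0 < β) (hb : 0 < b) (N : ℕ) :
    ∫ ξ in Ioi (0 : ℝ), ξ ^ (2 * N) * (ξ ^ (2 * β - 1) * Real.exp (-b * ξ ^ 2)) =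
      Real.Gamma β / 2 * b ^ (-β) * (poch β N / b ^ N) := by
  have h := integral_rpow_mul_exp_neg_mul_rpow (p := 2) (q := 2 * β - 1 + 2 * N) (b := b)
    two_pos (by have : (0 : ℝ) ≤ N := Nat.cast_nonneg N
                linarith) hb
  have h2 : (2 * β - 1 + 2 * (N : ℝ) + 1) / 2 = β + N := by ring
  have h3 : -(2 * β - 1 + 2 * (N : ℝ) + 1) / 2 = -β - N := by ring
  rw [h2, h3, Gamma_add_nat hβ, Real.rpow_sub hb, Real.rpow_natCast] at h
  rw [show Real.Gamma β / 2 * b ^ (-β) * (poch β N / b ^ N) =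
    b ^ (-β) / b ^ N * (1 / 2) * (poch β N * Real.Gamma β) by ring, ← h]
  refine setIntegral_congr_fun measurableSet_Ioi fun ξ hξ => ?_
  have hξ' : (0 : ℝ) < ξ := hξ
  rw [Real.rpow_add hξ', show (2 * (N : ℝ)) = ((2 * N : ℕ) : ℝ) by push_cast; ring,
    Real.rpow_natCast, Real.rpow_two]
  ring

lemma integrableOn_rpow_add_mul_exp_neg_mul_sq {β b : ℝ} (hβ : 0 < β) (hb : 0 < b) (N : ℕ) :
    IntegrableOn (fun ξ : ℝ => ξ ^ (2 * N) * (ξ ^ (2 * β - 1) * Real.exp (-b * ξ ^ 2)))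
      (Ioi 0) := by
  refine (integrableOn_rpow_mul_exp_neg_mul_sq hb (s := 2 * β - 1 + 2 * N) (by
    have : (0 : ℝ) ≤ N := Nat.cast_nonneg N
    linarith)).congr_fun (fun ξ hξ => ?_) measurableSet_Ioi
  have hξ' : (0 : ℝ) < ξ := hξ
  simp only
  rw [Real.rpow_add hξ', show (2 * (N : ℝ)) = ((2 * N : ℕ) : ℝ) by push_cast; ring,
    Real.rpow_natCast]
  ring

lemma hasSum_hyp_mul_hyp {β : ℝ} (hβ : 0 < β) (X T : ℝ) :
    HasSum (fun i : ℕ × ℕ => X ^ i.1 * T ^ i.2 /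
      (i.1.factorial * i.2.factorial * (poch β i.1 * poch β i.2))) (hyp β X * hyp β T) := by
  have h1 := (summable_hyp hβ X).norm
  have h2 := (summable_hyp hβ T).norm
  refine (congrArg (fun f => HasSum f _) (funext fun i => ?_)).mp
    ((hasSum_hyp hβ X).mul (hasSum_hyp hβ T) (summable_mul_of_summable_norm h1 h2))
  rw [div_mul_div_comm]
  congr 1
  ring

lemma hyp_pos {β v : ℝ} (hβ : 0 < β) (hv : 0 ≤ v) : 0 < hyp β v := by
  refine (summable_hyp hβ v).tsum_pos (fun k => ?_) 0 (by simp)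
  have := poch_pos hβ k
  positivity

/-- Weber's second exponential integral, for the product of two Bessel functions. -/
lemma hasIntegral_weber {β b : ℝ} (hβ : 0 < β) (hb : 0 < b) (x t : ℝ) :
    IntegrableOn (fun ξ : ℝ => hyp β (-(x * ξ) ^ 2 / 4) * hyp β (-(t * ξ) ^ 2 / 4) *
      (ξ ^ (2 * β - 1) * Real.exp (-b * ξ ^ 2))) (Ioi 0) ∧
    ∫ ξ in Ioi (0 : ℝ), hyp β (-(x * ξ) ^ 2 / 4) * hyp β (-(t * ξ) ^ 2 / 4) *
      (ξ ^ (2 * β - 1) * Real.exp (-b * ξ ^ 2)) =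
    Real.Gamma β / 2 * b ^ (-β) * (Real.exp (-(x ^ 2 + t ^ 2) / (4 * b)) *
      hyp β ((x * t / (2 * b)) ^ 2 / 4)) := by
  set X : ℝ := -x ^ 2 / (4 * b) with hX
  set T : ℝ := -t ^ 2 / (4 * b) with hT
  let c : ℕ × ℕ → ℝ := fun i => (-x ^ 2 / 4) ^ i.1 * (-t ^ 2 / 4) ^ i.2 /
    (i.1.factorial * i.2.factorial * (poch β i.1 * poch β i.2))
  let F : ℕ × ℕ → ℝ → ℝ := fun i ξ =>
    c i * (ξ ^ (2 * (i.1 + i.2)) * (ξ ^ (2 * β - 1) * Real.exp (-b * ξ ^ 2)))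
  have hF (i) : IntegrableOn (F i) (Ioi 0) :=
    (integrableOn_rpow_add_mul_exp_neg_mul_sq hβ hb (i.1 + i.2)).const_mul (c i)
  have hnorm (i) : ∫ ξ in Ioi (0 : ℝ), ‖F i ξ‖ = Real.Gamma β / 2 * b ^ (-β) *
      (|X| ^ i.1 * |T| ^ i.2 * poch β (i.1 + i.2) /
        (i.1.factorial * i.2.factorial * (poch β i.1 * poch β i.2))) := by
    have h1 := poch_pos hβ i.1
    have h2 := poch_pos hβ i.2
    have hc : |c i| = (x ^ 2 / 4) ^ i.1 * (t ^ 2 / 4) ^ i.2 /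
        (i.1.factorial * i.2.factorial * (poch β i.1 * poch β i.2)) := by
      simp only [c]
      rw [abs_div, abs_mul, abs_pow, abs_pow, abs_of_pos (a := (i.1.factorial : ℝ) * i.2.factorial * (poch β i.1 * poch β i.2)) (by positivity),
        neg_div, neg_div, abs_neg, abs_neg, abs_of_nonneg (by positivity),
        abs_of_nonneg (by positivity)]
    have hX' : |X| = x ^ 2 / 4 / b := by
      rw [hX, neg_div, abs_neg, abs_of_nonneg (by positivity)]; field_simp
    have hT' : |T| = t ^ 2 / 4 / b := by
      rw [hT, neg_div, abs_neg, abs_of_nonneg (by positivity)]; field_simp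
    have : ∫ ξ in Ioi (0 : ℝ), ‖F i ξ‖ = |c i| * ∫ ξ in Ioi (0 : ℝ),
        ξ ^ (2 * (i.1 + i.2)) * (ξ ^ (2 * β - 1) * Real.exp (-b * ξ ^ 2)) := by
      rw [← integral_const_mul]
      refine setIntegral_congr_fun measurableSet_Ioi fun ξ hξ => ?_
      have hξ' : (0 : ℝ) < ξ := hξ
      simp only [F, norm_mul, Real.norm_eq_abs]
      rw [abs_of_nonneg (a := ξ ^ (2 * (i.1 + i.2))) (by positivity),
        abs_of_nonneg (a := ξ ^ (2 * β - 1)) (by positivity), abs_of_pos (Real.exp_pos _)]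
    rw [this, integral_rpow_add_mul_exp_neg_mul_sq hβ hb, hc, hX', hT', div_pow _ b, div_pow _ b,
      pow_add]
    field_simp
  -- The integrated norms form the same double series at `|X|` and `|T|`, so sum and integral may be
  -- exchanged.
  have hsum : Summable fun i => ∫ ξ in Ioi (0 : ℝ), ‖F i ξ‖ := by
    simp_rw [hnorm]
    exact (hasSum_doubleSeries hβ |X| |T|).summable.mul_left _
  have htsum (ξ : ℝ) : HasSum (fun i => F i ξ) (hyp β (-(x * ξ) ^ 2 / 4) *
      hyp β (-(t * ξ) ^ 2 / 4) * (ξ ^ (2 * β - 1) * Real.exp (-b * ξ ^ 2))) := by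
    have h := hasSum_hyp_mul_hyp hβ (-(x * ξ) ^ 2 / 4) (-(t * ξ) ^ 2 / 4)
    refine (congrArg (fun f => HasSum f _) (funext fun i => ?_)).mp (h.mul_right (ξ ^ (2 * β - 1) * Real.exp (-b * ξ ^ 2)))
    simp only [F, c]
    rw [show -(x * ξ) ^ 2 / 4 = -x ^ 2 / 4 * ξ ^ 2 by ring,
      show -(t * ξ) ^ 2 / 4 = -t ^ 2 / 4 * ξ ^ 2 by ring, mul_pow _ (ξ ^ 2), mul_pow _ (ξ ^ 2),
      ← pow_mul, ← pow_mul, mul_add, pow_add]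
    ring
  have hmain := hasSum_integral_of_summable_integral_norm hF hsum
  have hval (i) : ∫ ξ in Ioi (0 : ℝ), F i ξ = Real.Gamma β / 2 * b ^ (-β) *
      (X ^ i.1 * T ^ i.2 * poch β (i.1 + i.2) /
        (i.1.factorial * i.2.factorial * (poch β i.1 * poch β i.2))) := by
    have h1 := poch_pos hβ i.1
    have h2 := poch_pos hβ i.2
    have hX' : X = -x ^ 2 / 4 / b := by rw [hX]; field_simp
    have hT' : T = -t ^ 2 / 4 / b := by rw [hT]; field_simp
    simp only [F]
    rw [integral_const_mul, integral_rpow_add_mul_exp_neg_mul_sq hβ hb, hX', hT', div_pow _ b,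
      div_pow _ b, pow_add]
    simp only [c]
    field_simp
  simp_rw [hval, fun ξ => (htsum ξ).tsum_eq] at hmain
  have heq : ∫ ξ in Ioi (0 : ℝ), hyp β (-(x * ξ) ^ 2 / 4) * hyp β (-(t * ξ) ^ 2 / 4) *
      (ξ ^ (2 * β - 1) * Real.exp (-b * ξ ^ 2)) =
      Real.Gamma β / 2 * b ^ (-β) * (Real.exp (-(x ^ 2 + t ^ 2) / (4 * b)) *
        hyp β ((x * t / (2 * b)) ^ 2 / 4)) := by
    rw [hmain.unique ((hasSum_doubleSeries hβ X T).mul_left _), ← Real.exp_add]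
    congr 3
    · rw [hX, hT]; ring
    · rw [hX, hT]; field_simp; ring
  refine ⟨?_, heq⟩
  -- The integral of a non-integrable function is `0` by convention, while the value just computed
  -- is positive.
  by_contra h
  rw [integral_undef h] at heq
  have h1 : 0 < hyp β ((x * t / (2 * b)) ^ 2 / 4) := hyp_pos hβ (by positivity)
  have h2 := Real.Gamma_pos_of_pos hβ
  have h3 := Real.exp_pos (-(x ^ 2 + t ^ 2) / (4 * b))
  exact absurd heq (by positivity)

/-! ### The Dunkl kernel in terms of `₀F₁` -/

/-- Only `z²` enters the series, so asking that `-(z/2)²` be real covers the real and the imaginary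
axis with one real function. -/
lemma normBessel_eq_hyp {α v : ℝ} (hα : 0 < α + 1) {z : ℂ} (hz : -(z / 2) ^ 2 = (v : ℂ)) :
    normBessel α z = (hyp (α + 1) v : ℂ) := by
  have hG := Real.Gamma_pos_of_pos hα
  rw [normBessel, ← tsum_mul_left, hyp, Complex.ofReal_tsum]
  refine tsum_congr fun n => ?_
  have : (n + α + 1 : ℝ) = α + 1 + n := by ring
  rw [this, Gamma_add_nat hα, pow_mul, ← mul_pow, show -1 * (z / 2) ^ 2 = (v : ℂ) by rw [← hz]; ring]
  have h1 : ((poch (α + 1) n : ℝ) : ℂ) ≠ 0 := by exact_mod_cast (poch_pos hα n).ne'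
  have h2 : ((Real.Gamma (α + 1) : ℝ) : ℂ) ≠ 0 := by exact_mod_cast hG.ne'
  push_cast
  field_simp

lemma dunklKernel_eq_hyp {lam v : ℝ} (hlam : 0 < lam) {w : ℂ} (hw : (w / 2) ^ 2 = (v : ℂ)) :
    dunklKernel lam w =
      (hyp (lam + 1 / 2) v : ℂ) + w / (2 * lam + 1 : ℝ) * (hyp (lam + 3 / 2) v : ℂ) := by
  have hz : -(-Complex.I * w / 2) ^ 2 = (v : ℂ) := by
    rw [← hw, div_pow, mul_pow, neg_sq, Complex.I_sq]; ring
  rw [dunklKernel, normBessel_eq_hyp (by linarith) hz, normBessel_eq_hyp (by linarith) hz,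
    show lam - 1 / 2 + 1 = lam + 1 / 2 by ring, show lam + 1 / 2 + 1 = lam + 3 / 2 by ring]

lemma dunklKernel_I_mul {lam : ℝ} (hlam : 0 < lam) (η : ℝ) :
    dunklKernel lam (Complex.I * η) =
      (hyp (lam + 1 / 2) (-η ^ 2 / 4) : ℂ) +
        Complex.I * η / (2 * lam + 1 : ℝ) * (hyp (lam + 3 / 2) (-η ^ 2 / 4) : ℂ) := by
  refine dunklKernel_eq_hyp hlam ?_
  push_cast
  rw [div_pow, mul_pow, Complex.I_sq]; ring

lemma dunklKernel_ofReal {lam : ℝ} (hlam : 0 < lam) (r : ℝ) :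
    dunklKernel lam r = ((hyp (lam + 1 / 2) (r ^ 2 / 4) +
      r / (2 * lam + 1) * hyp (lam + 3 / 2) (r ^ 2 / 4) : ℝ) : ℂ) := by
  rw [dunklKernel_eq_hyp hlam (v := r ^ 2 / 4) (by push_cast; ring)]
  push_cast
  rfl

/-! ### The Dunkl kernel as an average of exponentials -/

/-- The density `(1 + s) (1 - s²) ^ (lam - 1)` representing the Dunkl kernel on `(-1, 1)`. -/
noncomputable def dunklDensity (lam s : ℝ) : ℝ := (1 + s) * (1 - s ^ 2) ^ (lam - 1)

/-- The moments of the density `(1 - s²) ^ (lam - 1)` on `(-1, 1)`. -/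
noncomputable def evenMoment (lam : ℝ) (n : ℕ) : ℝ :=
  ∫ s in Ioo (-1 : ℝ) 1, s ^ n * (1 - s ^ 2) ^ (lam - 1)

lemma dunklDensity_eq {lam s : ℝ} (hs : s ∈ Ioo (-1 : ℝ) 1) :
    dunklDensity lam s = (1 + s) ^ lam * (1 - s) ^ (lam - 1) := by
  have h1 : 0 < 1 + s := by linarith [hs.1]
  have h2 : 0 < 1 - s := by linarith [hs.2]
  rw [dunklDensity, show 1 - s ^ 2 = (1 + s) * (1 - s) by ring, Real.mul_rpow h1.le h2.le,
    ← mul_assoc, Real.rpow_sub_one h1.ne']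
  field_simp

lemma dunklDensity_pos {lam s : ℝ} (hs : s ∈ Ioo (-1 : ℝ) 1) : 0 < dunklDensity lam s := by
  have h1 : 0 < 1 + s := by linarith [hs.1]
  have h2 : 0 < 1 - s := by linarith [hs.2]
  rw [dunklDensity_eq hs]
  positivity

lemma measurable_dunklDensity (lam : ℝ) : Measurable (dunklDensity lam) := by
  unfold dunklDensity; fun_prop

lemma integrableOn_one_sub_rpow {lam : ℝ} (hlam : 0 < lam) :
    IntegrableOn (fun s : ℝ => (1 - s) ^ (lam - 1)) (Ioo (-1) 1) := by
  have h := (intervalIntegral.intervalIntegrable_rpow' (a := 2) (b := 0)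
    (show -1 < lam - 1 by linarith)).comp_sub_left 1
  norm_num at h
  rw [intervalIntegrable_iff_integrableOn_Ioo_of_le (by norm_num)] at h
  exact h

lemma dunklDensity_le {lam s : ℝ} (hlam : 0 < lam) (hs : s ∈ Ioo (-1 : ℝ) 1) :
    dunklDensity lam s ≤ 2 ^ lam * (1 - s) ^ (lam - 1) := by
  have h1 : 0 < 1 + s := by linarith [hs.1]
  have h2 : 0 < 1 - s := by linarith [hs.2]
  rw [dunklDensity_eq hs]
  gcongr
  linarith [hs.2]

lemma integrableOn_dunklDensity {lam : ℝ} (hlam : 0 < lam) :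
    IntegrableOn (dunklDensity lam) (Ioo (-1) 1) := by
  refine Integrable.mono' ((integrableOn_one_sub_rpow hlam).const_mul (2 ^ lam))
    (measurable_dunklDensity lam).aestronglyMeasurable ?_
  filter_upwards [ae_restrict_mem measurableSet_Ioo] with s hs
  rw [Real.norm_of_nonneg (dunklDensity_pos hs).le]
  exact dunklDensity_le hlam hs

/-- The even density is half the sum of `dunklDensity` and its reflection, and `|s^n| ≤ 1`. -/
lemma integrableOn_pow_mul_evenDensity {lam : ℝ} (hlam : 0 < lam) (n : ℕ) :
    IntegrableOn (fun s : ℝ => s ^ n * (1 - s ^ 2) ^ (lam - 1)) (Ioo (-1) 1) := by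
  have h := integrableOn_dunklDensity hlam
  have h' : IntegrableOn (fun s : ℝ => dunklDensity lam (-s)) (Ioo (-1) 1) := by
    have h0 := (Measure.measurePreserving_neg (volume : Measure ℝ)).integrableOn_comp_preimage
      (Homeomorph.neg ℝ).measurableEmbedding (f := dunklDensity lam) (s := Ioo (-1) 1)
    have := h0.2 h
    simpa [Function.comp_def] using this
  refine Integrable.mono' ((h.add h').const_mul (1 / 2)) (by fun_prop) ?_
  filter_upwards [ae_restrict_mem measurableSet_Ioo] with s hs
  have h1 : 0 < 1 - s ^ 2 := by nlinarith [hs.1, hs.2]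
  have h2 : |s| ≤ 1 := abs_le.2 ⟨hs.1.le, hs.2.le⟩
  have h3 : (1 / 2 : ℝ) * (dunklDensity lam + fun s => dunklDensity lam (-s)) s =
      (1 - s ^ 2) ^ (lam - 1) := by
    simp only [Pi.add_apply, dunklDensity, neg_sq]; ring
  rw [h3, norm_mul, norm_pow, Real.norm_eq_abs, Real.norm_of_nonneg (by positivity)]
  exact mul_le_of_le_one_left (by positivity) (pow_le_one₀ (abs_nonneg _) h2)

/-- The derivative of `s^n (1 - s²)^lam` integrates to zero, since the function takes the value `0`
at both endpoints. At `n = 0` the truncated `n - 1` is harmless because of the factor `n`, and the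
identity says that the first moment vanishes. -/
lemma integral_deriv_pow_mul_evenDensity {lam : ℝ} (hlam : 0 < lam) (n : ℕ) :
    n * (evenMoment lam (n - 1) - evenMoment lam (n + 1)) =
      2 * lam * evenMoment lam (n + 1) := by
  have hi := integrableOn_pow_mul_evenDensity hlam
  have hint : IntegrableOn (fun s : ℝ => n * (s ^ (n - 1) * (1 - s ^ 2) ^ (lam - 1) -
      s ^ (n + 1) * (1 - s ^ 2) ^ (lam - 1)) -
      2 * lam * (s ^ (n + 1) * (1 - s ^ 2) ^ (lam - 1))) (Ioo (-1) 1) :=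
    (((hi (n - 1)).sub (hi (n + 1))).const_mul _).sub ((hi (n + 1)).const_mul _)
  have hd (s : ℝ) (hs : s ∈ Ioo (-1 : ℝ) 1) : HasDerivAt (fun s : ℝ => s ^ n * (1 - s ^ 2) ^ lam)
      (n * (s ^ (n - 1) * (1 - s ^ 2) ^ (lam - 1) - s ^ (n + 1) * (1 - s ^ 2) ^ (lam - 1)) -
      2 * lam * (s ^ (n + 1) * (1 - s ^ 2) ^ (lam - 1))) s := by
    have h1 : 0 < 1 - s ^ 2 := by nlinarith [hs.1, hs.2]
    have h2 : HasDerivAt (fun s : ℝ => 1 - s ^ 2) (-(2 * s)) s := by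
      simpa using (hasDerivAt_pow 2 s).const_sub 1
    refine ((hasDerivAt_pow n s).mul (h2.rpow_const (p := lam) (Or.inl h1.ne'))).congr_deriv ?_
    have h3 : (1 - s ^ 2) ^ lam = (1 - s ^ 2) ^ (lam - 1) * (1 - s ^ 2) := by
      rw [← Real.rpow_add_one h1.ne']; simp
    rw [h3]
    rcases n with _ | n
    · simp; ring
    · simp only [Nat.add_sub_cancel]; push_cast; ring
  have h := intervalIntegral.integral_eq_sub_of_hasDerivAt_of_le (by norm_num)
    (Continuous.continuousOn (by
      refine (continuous_pow n).mul (Continuous.rpow_const (by fun_prop) fun _ => Or.inr hlam.le)))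
    hd ((intervalIntegrable_iff_integrableOn_Ioo_of_le (by norm_num)).2 hint)
  have e1 := integral_sub (((hi (n - 1)).sub (hi (n + 1))).const_mul (n : ℝ))
    ((hi (n + 1)).const_mul (2 * lam))
  have e2 := integral_sub (hi (n - 1)) (hi (n + 1))
  rw [intervalIntegral.integral_of_le (by norm_num), integral_Ioc_eq_integral_Ioo] at h
  simp only [Pi.sub_apply] at e1 e2
  rw [e1, integral_const_mul, integral_const_mul, e2] at h
  norm_num [Real.zero_rpow hlam.ne'] at h
  simp only [evenMoment]
  linarith

lemma evenMoment_add_two {lam : ℝ} (hlam : 0 < lam) (n : ℕ) :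
    evenMoment lam (n + 2) = (n + 1) / (n + 1 + 2 * lam) * evenMoment lam n := by
  have h := integral_deriv_pow_mul_evenDensity hlam (n + 1)
  have : (0 : ℝ) < n + 1 + 2 * lam := by positivity
  push_cast at h
  simp only [add_assoc n 1 1, Nat.reduceAdd] at h
  rw [div_mul_eq_mul_div, eq_div_iff this.ne']
  linarith

lemma evenMoment_odd {lam : ℝ} (hlam : 0 < lam) (k : ℕ) : evenMoment lam (2 * k + 1) = 0 := by
  induction k with
  | zero =>
    have h := integral_deriv_pow_mul_evenDensity hlam 0
    simp at h
    simpa [hlam.ne'] using h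
  | succ k ih => rw [show 2 * (k + 1) + 1 = 2 * k + 1 + 2 by ring, evenMoment_add_two hlam, ih,
      mul_zero]

lemma evenMoment_even {lam : ℝ} (hlam : 0 < lam) (k : ℕ) :
    evenMoment lam (2 * k) = evenMoment lam 0 * (poch (1 / 2) k / poch (lam + 1 / 2) k) := by
  induction k with
  | zero => simp
  | succ k ih =>
    have h1 := poch_pos (show 0 < lam + 1 / 2 by positivity) k
    rw [show 2 * (k + 1) = 2 * k + 2 by ring, evenMoment_add_two hlam, ih, poch_succ, poch_succ]
    push_cast
    field_simp
    ring

lemma evenMoment_zero_pos {lam : ℝ} (hlam : 0 < lam) : 0 < evenMoment lam 0 := by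
  have h := intervalIntegral.intervalIntegral_pos_of_pos_on (a := -1) (b := 1)
    ((intervalIntegrable_iff_integrableOn_Ioo_of_le (by norm_num)).2
      (integrableOn_pow_mul_evenDensity hlam 0)) (fun s hs => ?_) (by norm_num)
  · rwa [intervalIntegral.integral_of_le (by norm_num), integral_Ioc_eq_integral_Ioo] at h
  · have h1 : 0 < 1 - s ^ 2 := by nlinarith [hs.1, hs.2]
    positivity

lemma integral_pow_mul_dunklDensity {lam : ℝ} (hlam : 0 < lam) (n : ℕ) :
    ∫ s in Ioo (-1 : ℝ) 1, s ^ n * dunklDensity lam s =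
      evenMoment lam n + evenMoment lam (n + 1) := by
  rw [evenMoment, evenMoment, ← integral_add (integrableOn_pow_mul_evenDensity hlam n)
    (integrableOn_pow_mul_evenDensity hlam (n + 1))]
  congr 1
  funext s
  rw [dunklDensity]; ring

lemma factorial_two_mul (k : ℕ) :
    ((2 * k).factorial : ℝ) = 4 ^ k * k.factorial * poch (1 / 2) k := by
  induction k with
  | zero => simp
  | succ k ih =>
    rw [show 2 * (k + 1) = 2 * k + 1 + 1 by ring, Nat.factorial_succ, Nat.factorial_succ,
      Nat.factorial_succ, poch_succ]
    push_cast
    rw [ih]; ring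

/-- The integral representation of the Dunkl kernel on the real and the imaginary axis. -/
lemma integral_exp_mul_dunklDensity {lam v : ℝ} (hlam : 0 < lam) {w : ℂ}
    (hw : (w / 2) ^ 2 = (v : ℂ)) :
    ∫ s in Ioo (-1 : ℝ) 1, Complex.exp (w * s) * (dunklDensity lam s : ℂ) =
      (evenMoment lam 0 : ℂ) * dunklKernel lam w := by
  let F : ℕ → ℝ → ℂ := fun n s => w ^ n / n.factorial * ((s ^ n * dunklDensity lam s : ℝ) : ℂ)
  have hk (n : ℕ) : IntegrableOn (fun s : ℝ => s ^ n * dunklDensity lam s) (Ioo (-1) 1) := by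
    refine ((integrableOn_pow_mul_evenDensity hlam n).add
      (integrableOn_pow_mul_evenDensity hlam (n + 1))).congr (ae_of_all _ fun s => ?_)
    simp only [Pi.add_apply, dunklDensity]; ring
  have hF (n) : IntegrableOn (F n) (Ioo (-1) 1) := (hk n).ofReal.const_mul _
  have hnorm (n) : ∫ s in Ioo (-1 : ℝ) 1, ‖F n s‖ ≤
      ‖w‖ ^ n / n.factorial * ∫ s in Ioo (-1 : ℝ) 1, dunklDensity lam s := by
    rw [← integral_const_mul]
    refine setIntegral_mono_on (hF n).norm ((integrableOn_dunklDensity hlam).const_mul _)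
      measurableSet_Ioo fun s hs => ?_
    have h2 : |s| ≤ 1 := abs_le.2 ⟨hs.1.le, hs.2.le⟩
    simp only [F]
    rw [norm_mul, norm_div, norm_pow, Complex.norm_natCast, Complex.norm_real, norm_mul, norm_pow,
      Real.norm_of_nonneg (dunklDensity_pos hs).le]
    refine mul_le_mul_of_nonneg_left ?_ (by positivity)
    exact mul_le_of_le_one_left (dunklDensity_pos hs).le (pow_le_one₀ (abs_nonneg _) h2)
  have hsum : Summable fun n => ∫ s in Ioo (-1 : ℝ) 1, ‖F n s‖ :=
    Summable.of_nonneg_of_le (fun n => integral_nonneg fun s => norm_nonneg _) hnorm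
      ((Real.summable_pow_div_factorial ‖w‖).mul_right _)
  have hmain := hasSum_integral_of_summable_integral_norm hF hsum
  have htsum (s : ℝ) : ∑' n, F n s = Complex.exp (w * s) * (dunklDensity lam s : ℂ) := by
    have h : HasSum (fun n : ℕ => (w * s) ^ n / n.factorial) (Complex.exp (w * s)) := by
      rw [Complex.exp_eq_exp_ℂ]; exact NormedSpace.expSeries_div_hasSum_exp (w * s)
    rw [← (h.mul_right _).tsum_eq]
    refine tsum_congr fun n => ?_
    simp only [F]
    push_cast
    rw [mul_pow]; ring
  have hval (n) : ∫ s in Ioo (-1 : ℝ) 1, F n s =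
      w ^ n / n.factorial * ((evenMoment lam n + evenMoment lam (n + 1) : ℝ) : ℂ) := by
    simp only [F]
    rw [integral_const_mul, integral_complex_ofReal, integral_pow_mul_dunklDensity hlam]
  simp_rw [hval, htsum] at hmain
  refine hmain.unique ?_
  have hw2 : w ^ 2 = 4 * (v : ℂ) := by rw [← hw]; ring
  rw [dunklKernel_eq_hyp hlam hw, mul_add]
  have c1 (k : ℕ) : (poch (lam + 1 / 2) k : ℂ) ≠ 0 := by
    exact_mod_cast (poch_pos (show 0 < lam + 1 / 2 by positivity) k).ne'
  have c2 (k : ℕ) : (poch (lam + 3 / 2) k : ℂ) ≠ 0 := by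
    exact_mod_cast (poch_pos (show 0 < lam + 3 / 2 by positivity) k).ne'
  have c3 (k : ℕ) : (poch (1 / 2) k : ℂ) ≠ 0 := by
    exact_mod_cast (poch_pos (show (0 : ℝ) < 1 / 2 by positivity) k).ne'
  have c4 (k : ℕ) : (k.factorial : ℂ) ≠ 0 := by exact_mod_cast k.factorial_ne_zero
  have c5 : (2 * lam + 1 : ℂ) ≠ 0 := by
    exact_mod_cast (show (0 : ℝ) < 2 * lam + 1 by positivity).ne'
  have c6 (k : ℕ) : (2 * k + 1 : ℂ) ≠ 0 := by
    have : ((2 * k + 1 : ℕ) : ℂ) ≠ 0 := Nat.cast_ne_zero.2 (Nat.succ_ne_zero _)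
    simpa using this
  have hf (k : ℕ) : ((2 * k).factorial : ℂ) = 4 ^ k * k.factorial * (poch (1 / 2) k : ℂ) := by
    exact_mod_cast factorial_two_mul k
  -- The coefficient of `w^n` contains the moments `n` and `n + 1`, of which only the even one
  -- survives. Even powers build the first Bessel term of the kernel, odd powers the second.
  refine HasSum.even_add_odd ?_ ?_
  · have h := Complex.hasSum_ofReal.2 (hasSum_hyp (show 0 < lam + 1 / 2 by positivity) v)
    refine (congrArg (fun f => HasSum f _) (funext fun k => ?_)).mp
      (h.mul_left (evenMoment lam 0 : ℂ))
    rw [evenMoment_odd hlam, add_zero, evenMoment_even hlam, pow_mul, hw2, hf, mul_pow]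
    push_cast
    have := c1 k; have := c3 k; have := c4 k
    field_simp
  · have h := Complex.hasSum_ofReal.2 (hasSum_hyp (show 0 < lam + 3 / 2 by positivity) v)
    refine (congrArg (fun f => HasSum f _) (funext fun k => ?_)).mp
      ((h.mul_left (w / (2 * lam + 1 : ℝ) : ℂ)).mul_left (evenMoment lam 0 : ℂ))
    rw [evenMoment_odd hlam, zero_add, show 2 * k + 1 + 1 = 2 * (k + 1) by ring,
      evenMoment_even hlam, pow_succ w, pow_mul, hw2, mul_pow, Nat.factorial_succ, poch_succ,
      poch_succ_left (lam + 1 / 2), show lam + 1 / 2 + 1 = lam + 3 / 2 by ring]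
    push_cast
    rw [hf]
    have := c2 k; have := c3 k; have := c4 k; have := c6 k
    have c7 : (lam + 1 / 2 : ℂ) = (2 * lam + 1) / 2 := by ring
    rw [c7]
    field_simp
    ring

lemma integral_dunklDensity {lam : ℝ} (hlam : 0 < lam) :
    ∫ s in Ioo (-1 : ℝ) 1, dunklDensity lam s = evenMoment lam 0 := by
  have h := integral_pow_mul_dunklDensity hlam 0
  have h1 := evenMoment_odd hlam 0
  simp only [pow_zero, one_mul, mul_zero, zero_add] at h h1
  rw [h, h1, add_zero]

lemma integral_exp_I_mul_dunklDensity {lam : ℝ} (hlam : 0 < lam) (η : ℝ) :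
    ∫ s in Ioo (-1 : ℝ) 1, Complex.exp (Complex.I * η * s) * (dunklDensity lam s : ℂ) =
      (evenMoment lam 0 : ℂ) * dunklKernel lam (Complex.I * η) := by
  refine integral_exp_mul_dunklDensity hlam (v := -η ^ 2 / 4) ?_
  push_cast
  rw [div_pow, mul_pow, Complex.I_sq]; ring

/-- On the imaginary axis the kernel is an average of unimodular exponentials against a positive
density, normalized by its total mass. -/
lemma norm_dunklKernel_I_mul_le {lam : ℝ} (hlam : 0 < lam) (η : ℝ) :
    ‖dunklKernel lam (Complex.I * η)‖ ≤ 1 := by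
  have hpos := evenMoment_zero_pos hlam
  have h := congrArg norm (integral_exp_I_mul_dunklDensity hlam η)
  rw [norm_mul, Complex.norm_real, Real.norm_of_nonneg hpos.le] at h
  have h1 := norm_integral_le_of_norm_le (f := fun s : ℝ =>
    Complex.exp (Complex.I * η * s) * (dunklDensity lam s : ℂ)) (integrableOn_dunklDensity hlam)
    (by
      filter_upwards [ae_restrict_mem measurableSet_Ioo] with s hs
      rw [norm_mul, Complex.norm_real, Real.norm_of_nonneg (dunklDensity_pos hs).le,
        show Complex.I * η * s = ((η * s : ℝ) : ℂ) * Complex.I by push_cast; ring,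
        Complex.norm_exp_ofReal_mul_I, one_mul])
  rw [h, integral_dunklDensity hlam] at h1
  exact le_of_mul_le_mul_left (by simpa using h1) hpos

lemma continuous_dunklKernel_I_mul {lam : ℝ} (hlam : 0 < lam) :
    Continuous fun η : ℝ => dunklKernel lam (Complex.I * η) := by
  have hpos := evenMoment_zero_pos hlam
  have h : Continuous fun η : ℝ => ∫ s in Ioo (-1 : ℝ) 1,
      Complex.exp (Complex.I * η * s) * (dunklDensity lam s : ℂ) := by
    refine continuous_of_dominated (bound := dunklDensity lam) (fun η => ?_) (fun η => ?_)
      (integrableOn_dunklDensity hlam) (ae_of_all _ fun s => by fun_prop)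
    · refine Measurable.aestronglyMeasurable ?_
      have := measurable_dunklDensity lam
      fun_prop
    · filter_upwards [ae_restrict_mem measurableSet_Ioo] with s hs
      rw [norm_mul, Complex.norm_real, Real.norm_of_nonneg (dunklDensity_pos hs).le,
        show Complex.I * η * s = ((η * s : ℝ) : ℂ) * Complex.I by push_cast; ring,
        Complex.norm_exp_ofReal_mul_I, one_mul]
  have h2 := h.const_mul (evenMoment lam 0 : ℂ)⁻¹
  refine h2.congr fun η => ?_
  have : (evenMoment lam 0 : ℂ) ≠ 0 := by exact_mod_cast hpos.ne'
  rw [integral_exp_I_mul_dunklDensity hlam]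
  field_simp

lemma integral_rexp_mul_dunklDensity {lam : ℝ} (hlam : 0 < lam) (r : ℝ) :
    ∫ s in Ioo (-1 : ℝ) 1, Real.exp (r * s) * dunklDensity lam s =
      evenMoment lam 0 * (hyp (lam + 1 / 2) (r ^ 2 / 4) +
      r / (2 * lam + 1) * hyp (lam + 3 / 2) (r ^ 2 / 4)) := by
  have h := integral_exp_mul_dunklDensity hlam (v := r ^ 2 / 4) (w := r) (by push_cast; ring)
  rw [dunklKernel_ofReal hlam] at h
  have h2 : ∫ s in Ioo (-1 : ℝ) 1, Complex.exp (r * s) * (dunklDensity lam s : ℂ) =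
      ∫ s in Ioo (-1 : ℝ) 1, ((Real.exp (r * s) * dunklDensity lam s : ℝ) : ℂ) := by
    congr 1; funext s; push_cast; rfl
  rw [h2, integral_complex_ofReal] at h
  exact_mod_cast h

/-! ### Gaussian integrals against the Dunkl weight -/

lemma weight_nonneg (lam x : ℝ) : 0 ≤ weight lam x := by unfold weight; positivity

lemma continuous_weight {lam : ℝ} (hlam : 0 < lam) : Continuous (weight lam) :=
  continuous_abs.rpow_const fun _ => Or.inr (by positivity)

lemma measurable_weight (lam : ℝ) : Measurable (weight lam) := by
  unfold weight; fun_prop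

lemma integral_gaussian_mul_weight {lam b : ℝ} (hlam : 0 < lam) (hb : 0 < b) :
    ∫ ξ : ℝ, Real.exp (-b * ξ ^ 2) * weight lam ξ =
      Real.Gamma (lam + 1 / 2) * b ^ (-(lam + 1 / 2)) := by
  have h := integral_comp_abs (f := fun ξ : ℝ => Real.exp (-b * ξ ^ 2) * ξ ^ (2 * lam))
  simp only [sq_abs] at h
  have h2 := integral_rpow_add_mul_exp_neg_mul_sq (show 0 < lam + 1 / 2 by positivity) hb 0
  simp only [weight]
  rw [h, show Real.Gamma (lam + 1 / 2) * b ^ (-(lam + 1 / 2)) =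
    2 * (Real.Gamma (lam + 1 / 2) / 2 * b ^ (-(lam + 1 / 2)) *
      (poch (lam + 1 / 2) 0 / b ^ 0)) by rw [poch_zero]; ring, ← h2]
  congr 1
  refine integral_congr_ae (ae_of_all _ fun ξ => ?_)
  simp only [mul_zero, pow_zero, one_mul]
  rw [show 2 * (lam + 1 / 2) - 1 = 2 * lam by ring, mul_comm]

lemma integrable_gaussian_mul_weight {lam b : ℝ} (hlam : 0 < lam) (hb : 0 < b) :
    Integrable fun ξ : ℝ => Real.exp (-b * ξ ^ 2) * weight lam ξ := by
  by_contra h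
  have heq := integral_gaussian_mul_weight hlam hb
  rw [integral_undef h] at heq
  have := Real.Gamma_pos_of_pos (show 0 < lam + 1 / 2 by positivity)
  exact absurd heq (by positivity)

/-- The Dunkl kernel `E_lam(r)` at a real argument. -/
noncomputable def realKernel (lam r : ℝ) : ℝ :=
  hyp (lam + 1 / 2) (r ^ 2 / 4) + r / (2 * lam + 1) * hyp (lam + 3 / 2) (r ^ 2 / 4)

lemma realKernel_zero (lam : ℝ) : realKernel lam 0 = 1 := by simp [realKernel, hyp_zero]

/-- The Dunkl heat kernel: the Gaussian integral of a product of two Dunkl kernels. -/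
lemma integral_gaussian_mul_dunklKernel {lam b : ℝ} (hlam : 0 < lam) (hb : 0 < b) (x t : ℝ) :
    ∫ ξ : ℝ, ((Real.exp (-b * ξ ^ 2) * weight lam ξ : ℝ) : ℂ) *
      (dunklKernel lam (Complex.I * (x * ξ : ℝ)) * dunklKernel lam (Complex.I * (t * ξ : ℝ))) =
    ((Real.Gamma (lam + 1 / 2) * b ^ (-(lam + 1 / 2)) *
      (Real.exp (-(x ^ 2 + t ^ 2) / (4 * b)) * realKernel lam (-(x * t) / (2 * b))) : ℝ) : ℂ) := by
  set f : ℝ → ℂ := fun ξ => ((Real.exp (-b * ξ ^ 2) * weight lam ξ : ℝ) : ℂ) *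
      (dunklKernel lam (Complex.I * (x * ξ : ℝ)) * dunklKernel lam (Complex.I * (t * ξ : ℝ)))
    with hf
  have hcont (x : ℝ) : Continuous fun ξ : ℝ => dunklKernel lam (Complex.I * (x * ξ : ℝ)) :=
    (continuous_dunklKernel_I_mul hlam).comp (continuous_const.mul continuous_id)
  have hfi : Integrable f := by
    refine (integrable_gaussian_mul_weight hlam hb).ofReal.mul_bdd (c := 1)
      ((hcont x).mul (hcont t)).aestronglyMeasurable (ae_of_all _ fun ξ => ?_)
    rw [norm_mul]
    exact mul_le_one₀ (norm_dunklKernel_I_mul_le hlam _) (norm_nonneg _)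
      (norm_dunklKernel_I_mul_le hlam _)
  let β := lam + 1 / 2
  let G₁ : ℝ → ℝ := fun ξ => hyp β (-(x * ξ) ^ 2 / 4) * hyp β (-(t * ξ) ^ 2 / 4) *
      (ξ ^ (2 * β - 1) * Real.exp (-b * ξ ^ 2))
  let G₂ : ℝ → ℝ := fun ξ => hyp (β + 1) (-(x * ξ) ^ 2 / 4) * hyp (β + 1) (-(t * ξ) ^ 2 / 4) *
      (ξ ^ (2 * (β + 1) - 1) * Real.exp (-b * ξ ^ 2))
  let G : ℝ → ℝ := fun ξ => G₁ ξ - x * t / (2 * lam + 1) ^ 2 * G₂ ξ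
  have hβ : 0 < β := by positivity
  have h1 := hasIntegral_weber hβ hb x t
  have h2 := hasIntegral_weber (show 0 < β + 1 by positivity) hb x t
  -- Symmetrizing in `ξ` kills the mixed even-odd products. The product of the two odd parts carries
  -- `I² = -1`, hence the minus sign in `G`.
  have heven (ξ : ℝ) (hξ : ξ ≠ 0) : f ξ + f (-ξ) = ((2 * G |ξ| : ℝ) : ℂ) := by
    have hξ' : 0 < |ξ| := abs_pos.2 hξ
    have e1 : |ξ| ^ (2 * β - 1) = |ξ| ^ (2 * lam) := by
      congr 1; simp only [β]; ring
    have e2 : |ξ| ^ (2 * (β + 1) - 1) = |ξ| ^ (2 * lam) * ξ ^ 2 := by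
      rw [show 2 * (β + 1) - 1 = 2 * lam + (2 : ℕ) by simp only [β]; push_cast; ring,
        Real.rpow_add hξ', Real.rpow_natCast, sq_abs]
    simp only [hf, G, G₁, G₂, dunklKernel_I_mul hlam, weight, abs_neg, e1, e2]
    simp only [mul_neg, neg_sq, mul_pow, sq_abs]
    rw [show β = lam + 1 / 2 from rfl, show lam + 1 / 2 + 1 = lam + 3 / 2 by ring]
    generalize 2 * lam + 1 = c
    push_cast
    linear_combination (2 * x * t * ξ ^ 2 * Complex.exp (-b * ξ ^ 2) * (|ξ| ^ (2 * lam) : ℝ) /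
      c ^ 2 * (hyp (lam + 3 / 2) (-(x ^ 2 * ξ ^ 2) / 4)) *
      (hyp (lam + 3 / 2) (-(t ^ 2 * ξ ^ 2) / 4)) : ℂ) * Complex.I_sq
  have hint : 2 * ∫ ξ, f ξ = ((2 * ∫ ξ : ℝ, G |ξ| : ℝ) : ℂ) := by
    have hneg : ∫ ξ, f (-ξ) = ∫ ξ, f ξ := integral_neg_eq_self f volume
    have : ∫ ξ, (f ξ + f (-ξ)) = 2 * ∫ ξ, f ξ := by
      rw [integral_add hfi hfi.comp_neg, hneg, two_mul]
    rw [← this, ← integral_const_mul, ← integral_complex_ofReal]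
    refine integral_congr_ae ?_
    filter_upwards [compl_mem_ae_iff.2 (measure_singleton (0 : ℝ))] with ξ hξ
    exact heven ξ hξ
  have h4 : ∫ ξ : ℝ, G |ξ| = Real.Gamma (lam + 1 / 2) * b ^ (-(lam + 1 / 2)) *
      (Real.exp (-(x ^ 2 + t ^ 2) / (4 * b)) * realKernel lam (-(x * t) / (2 * b))) := by
    -- Weber's formula is used with parameters `β` and `β + 1`. The extra factor `β / b` of the
    -- second, with `β = (2 lam + 1)/2`, turns `x t / (2 lam + 1)²` into the coefficient of the odd
    -- part of `realKernel`.
    rw [integral_comp_abs, integral_sub h1.1 (h2.1.const_mul _), integral_const_mul, h1.2, h2.2,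
      Real.Gamma_add_one hβ.ne', realKernel, show -(β + 1) = -β + -1 by ring, Real.rpow_add hb, Real.rpow_neg_one,
      show β + 1 = lam + 3 / 2 by simp only [β]; ring,
      show (-(x * t) / (2 * b)) ^ 2 = (x * t / (2 * b)) ^ 2 by ring]
    simp only [β]
    have : (2 * lam + 1) ≠ 0 := by positivity
    field_simp
    ring
  rw [h4] at hint
  push_cast at hint ⊢
  exact mul_left_cancel₀ two_ne_zero hint

/-! ### Superpositions of Gaussians and the translated Poisson kernel -/

/-- Tonelli: the `ξ`-integral of each Gaussian is a constant times `b s ^ (-(lam + 1/2))`, so `hint`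
expresses finite total mass, and the bounded factor `g` does no harm. -/
lemma integrable_gaussian_mixture {lam : ℝ} (hlam : 0 < lam) {φ b : ℝ → ℝ} (hφ : Measurable φ)
    (hφ0 : ∀ s, 0 < s → 0 ≤ φ s) (hb : Measurable b) (hb0 : ∀ s, 0 < s → 0 < b s)
    (hint : IntegrableOn (fun s => φ s * b s ^ (-(lam + 1 / 2))) (Ioi 0))
    {g : ℝ → ℂ} (hg : Continuous g) (hg1 : ∀ ξ, ‖g ξ‖ ≤ 1) :
    Integrable (fun z : ℝ × ℝ =>
      ((φ z.1 * (Real.exp (-b z.1 * z.2 ^ 2) * weight lam z.2) : ℝ) : ℂ) * g z.2)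
      ((volume.restrict (Ioi 0)).prod volume) := by
  have hw := measurable_weight lam
  have hmeas : Measurable fun z : ℝ × ℝ =>
      φ z.1 * (Real.exp (-b z.1 * z.2 ^ 2) * weight lam z.2) := by
    refine (hφ.comp measurable_fst).mul (Measurable.mul ?_ (hw.comp measurable_snd))
    exact ((hb.comp measurable_fst).neg.mul (measurable_snd.pow_const 2)).exp
  suffices hr : Integrable (fun z : ℝ × ℝ =>
      φ z.1 * (Real.exp (-b z.1 * z.2 ^ 2) * weight lam z.2))
      ((volume.restrict (Ioi 0)).prod volume) from
    hr.ofReal.mul_bdd (c := 1) (hg.comp continuous_snd).aestronglyMeasurable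
      (ae_of_all _ fun z => hg1 _)
  rw [integrable_prod_iff hmeas.aestronglyMeasurable]
  constructor
  · filter_upwards [ae_restrict_mem measurableSet_Ioi] with s hs
    exact (integrable_gaussian_mul_weight hlam (hb0 s hs)).const_mul _
  · refine (hint.const_mul (Real.Gamma (lam + 1 / 2))).congr ?_
    filter_upwards [ae_restrict_mem measurableSet_Ioi] with s hs
    have : ∀ ξ, ‖φ s * (Real.exp (-b s * ξ ^ 2) * weight lam ξ)‖ =
        φ s * (Real.exp (-b s * ξ ^ 2) * weight lam ξ) := fun ξ =>
      Real.norm_of_nonneg (mul_nonneg (hφ0 s hs)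
        (mul_nonneg (Real.exp_pos _).le (weight_nonneg _ _)))
    simp only [this]
    rw [integral_const_mul, integral_gaussian_mul_weight hlam (hb0 s hs)]
    ring

/-- A superposition of Gaussians is integrated against `g` Gaussian by Gaussian. -/
lemma integral_gaussian_mixture_mul {lam : ℝ} (hlam : 0 < lam) {φ b : ℝ → ℝ} (hφ : Measurable φ)
    (hφ0 : ∀ s, 0 < s → 0 ≤ φ s) (hb : Measurable b) (hb0 : ∀ s, 0 < s → 0 < b s)
    (hint : IntegrableOn (fun s => φ s * b s ^ (-(lam + 1 / 2))) (Ioi 0))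
    {g : ℝ → ℂ} (hg : Continuous g) (hg1 : ∀ ξ, ‖g ξ‖ ≤ 1) :
    ∫ ξ : ℝ, ((∫ s in Ioi (0 : ℝ), φ s * Real.exp (-b s * ξ ^ 2) : ℝ) : ℂ) * g ξ *
      (weight lam ξ : ℂ) =
    ∫ s in Ioi (0 : ℝ), (φ s : ℂ) *
      ∫ ξ : ℝ, ((Real.exp (-b s * ξ ^ 2) * weight lam ξ : ℝ) : ℂ) * g ξ := by
  have h := integral_integral_swap (f := fun s ξ =>
    ((φ s * (Real.exp (-b s * ξ ^ 2) * weight lam ξ) : ℝ) : ℂ) * g ξ)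
    (integrable_gaussian_mixture hlam hφ hφ0 hb hb0 hint hg hg1)
  rw [show (∫ s in Ioi (0 : ℝ), (φ s : ℂ) *
      ∫ ξ : ℝ, ((Real.exp (-b s * ξ ^ 2) * weight lam ξ : ℝ) : ℂ) * g ξ) =
      ∫ s in Ioi (0 : ℝ), ∫ ξ : ℝ, ((φ s * (Real.exp (-b s * ξ ^ 2) * weight lam ξ) : ℝ) : ℂ) *
        g ξ from ?_, h]
  · refine integral_congr_ae (ae_of_all _ fun ξ => ?_)
    simp only
    rw [← integral_complex_ofReal, mul_assoc, ← integral_mul_const]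
    refine integral_congr_ae (ae_of_all _ fun s => ?_)
    push_cast; ring
  · refine integral_congr_ae (ae_of_all _ fun s => ?_)
    simp only
    rw [← integral_const_mul]
    refine integral_congr_ae (ae_of_all _ fun ξ => ?_)
    push_cast; ring

lemma integrableOn_rpow_mul_exp_neg {a r : ℝ} (ha : 0 < a) (hr : 0 < r) :
    IntegrableOn (fun s : ℝ => s ^ (a - 1) * Real.exp (-(r * s))) (Ioi 0) := by
  simpa using integrableOn_rpow_mul_exp_neg_mul_rpow (s := a - 1) (p := 1) (by linarith)
    one_pos hr

lemma poissonKernel_eq_integral {lam y : ℝ} (hlam : 0 < lam) (hy : 0 < y) (x : ℝ) :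
    poissonKernel lam y x = (((2 : ℝ) ^ (lam + 1 / 2) / Real.sqrt Real.pi * y : ℝ) : ℂ) *
      ((∫ s in Ioi (0 : ℝ), s ^ lam * Real.exp (-(y ^ 2 * s)) * Real.exp (-s * x ^ 2) : ℝ) : ℂ) := by
  have hr : 0 < x ^ 2 + y ^ 2 := by positivity
  have h := Real.integral_rpow_mul_exp_neg_mul_Ioi (a := lam + 1) (by positivity) hr
  have h2 : ∫ s in Ioi (0 : ℝ), s ^ lam * Real.exp (-(y ^ 2 * s)) * Real.exp (-s * x ^ 2) =
      (1 / (x ^ 2 + y ^ 2)) ^ (lam + 1) * Real.Gamma (lam + 1) := by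
    rw [← h]
    refine integral_congr_ae (ae_of_all _ fun s => ?_)
    simp only
    rw [mul_assoc, ← Real.exp_add, add_sub_cancel_right]
    congr 2; ring
  rw [h2, poissonKernel, ← Complex.ofReal_mul, one_div (x ^ 2 + y ^ 2),
    Real.inv_rpow hr.le]
  congr 1
  field_simp

/-- The kernel of the Poisson integral, up to a constant factor:
`∫₋₁¹ (1 + s) (1 - s²) ^ (lam - 1) (y² + x² + t² - 2 x t s) ^ (-lam - 1) ds`. -/
noncomputable def poissonDensity (lam y x t : ℝ) : ℝ :=
  ∫ s in Ioo (-1 : ℝ) 1, dunklDensity lam s *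
    (y ^ 2 + x ^ 2 + t ^ 2 - 2 * x * t * s) ^ (-(lam + 1))

/-- The form is affine in `s`, and its minimum over `[-1, 1]` is attained at an endpoint. -/
lemma le_quadForm {y x t s : ℝ} (hs : s ∈ Icc (-1 : ℝ) 1) :
    y ^ 2 + (|x| - |t|) ^ 2 ≤ y ^ 2 + x ^ 2 + t ^ 2 - 2 * x * t * s := by
  have h1 : x * t * s ≤ |x| * |t| := by
    refine (le_abs_self _).trans ?_
    rw [abs_mul, abs_mul]
    exact mul_le_of_le_one_right (by positivity) (abs_le.2 hs)
  nlinarith [sq_abs x, sq_abs t]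

lemma quadForm_pos {y x t s : ℝ} (hy : 0 < y) (hs : s ∈ Icc (-1 : ℝ) 1) :
    0 < y ^ 2 + x ^ 2 + t ^ 2 - 2 * x * t * s :=
  lt_of_lt_of_le (by positivity) (le_quadForm hs)

/-- The transform is kept as a superposition of Gaussians instead of `exp (-y |ξ|)`, so that the
exchange of integrals applies again in the translation. -/
lemma dunklTransform_poissonKernel {lam y : ℝ} (hlam : 0 < lam) (hy : 0 < y) (ξ : ℝ) :
    dunklTransform lam (poissonKernel lam y) ξ =
      ((cConst lam * ((2 : ℝ) ^ (lam + 1 / 2) / Real.sqrt Real.pi * y) *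
        Real.Gamma (lam + 1 / 2) : ℝ) : ℂ) *
      ((∫ s in Ioi (0 : ℝ), s ^ (-(1 / 2) : ℝ) * Real.exp (-(y ^ 2 * s)) *
        Real.exp (-(1 / (4 * s)) * ξ ^ 2) : ℝ) : ℂ) := by
  have hcont : Continuous fun x : ℝ => dunklKernel lam (Complex.I * ((-ξ * x : ℝ) : ℂ)) :=
    (continuous_dunklKernel_I_mul hlam).comp (continuous_const.mul continuous_id)
  have h := integral_gaussian_mixture_mul hlam
    (φ := fun s => s ^ lam * Real.exp (-(y ^ 2 * s))) (b := fun s => s) (by fun_prop)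
    (fun s hs => by positivity) measurable_id (fun s hs => hs) ?_ hcont
    (fun x => norm_dunklKernel_I_mul_le hlam _)
  · rw [dunklTransform]
    have e (x : ℝ) : poissonKernel lam y x * dunklKernel lam (-Complex.I * x * ξ) *
        (weight lam x : ℂ) = (((2 : ℝ) ^ (lam + 1 / 2) / Real.sqrt Real.pi * y : ℝ) : ℂ) *
        (((∫ s in Ioi (0 : ℝ), s ^ lam * Real.exp (-(y ^ 2 * s)) * Real.exp (-s * x ^ 2) : ℝ) : ℂ) *
        dunklKernel lam (Complex.I * ((-ξ * x : ℝ) : ℂ)) * (weight lam x : ℂ)) := by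
      rw [poissonKernel_eq_integral hlam hy, show -Complex.I * x * ξ =
        Complex.I * ((-ξ * x : ℝ) : ℂ) by push_cast; ring]
      ring
    simp_rw [e]
    rw [integral_const_mul, h]
    have e2 : ∫ s in Ioi (0 : ℝ), ((s ^ lam * Real.exp (-(y ^ 2 * s)) : ℝ) : ℂ) *
        ∫ x : ℝ, ((Real.exp (-s * x ^ 2) * weight lam x : ℝ) : ℂ) *
          dunklKernel lam (Complex.I * ((-ξ * x : ℝ) : ℂ)) =
        ∫ s in Ioi (0 : ℝ), ((Real.Gamma (lam + 1 / 2) * (s ^ (-(1 / 2) : ℝ) *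
          Real.exp (-(y ^ 2 * s)) * Real.exp (-(1 / (4 * s)) * ξ ^ 2)) : ℝ) : ℂ) := by
      refine setIntegral_congr_fun measurableSet_Ioi fun s hs => ?_
      have hs : 0 < s := hs
      -- Frequency `0` makes the second Dunkl kernel equal to `1`, leaving the transform of a single
      -- Gaussian.
      have hg := integral_gaussian_mul_dunklKernel hlam hs (-ξ) 0
      have h1 : dunklKernel lam 0 = 1 := by
        rw [show (0 : ℂ) = ((0 : ℝ) : ℂ) by simp, dunklKernel_ofReal hlam, ← realKernel,
          realKernel_zero, Complex.ofReal_one]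
      simp only [zero_mul, Complex.ofReal_zero, mul_zero, h1, mul_one, neg_zero, zero_div,
        realKernel_zero] at hg
      rw [hg, ← Complex.ofReal_mul, show (-(1 / 2) : ℝ) = lam + -(lam + 1 / 2) by ring,
        Real.rpow_add hs]
      congr 1
      rw [show -((-ξ) ^ 2 + 0 ^ 2) / (4 * s) = -(1 / (4 * s)) * ξ ^ 2 by ring]
      ring
    rw [e2, integral_complex_ofReal, integral_const_mul]
    push_cast
    ring
  · refine (integrableOn_rpow_mul_exp_neg (a := 1 / 2) (r := y ^ 2) (by norm_num)
      (by positivity)).congr_fun (fun s hs => ?_) measurableSet_Ioi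
    have hs : 0 < s := hs
    simp only
    rw [show (1 / 2 - 1 : ℝ) = lam + -(lam + 1 / 2) by ring, Real.rpow_add hs]
    ring

/-- With `realKernel` written as an average of `exp (2 r x t s)`, the exponents combine to `-q r`,
where `q` is the quadratic form, and the `r`-integral is a Gamma integral. -/
lemma integral_rpow_mul_exp_mul_realKernel {lam y : ℝ} (hlam : 0 < lam) (hy : 0 < y) (x t : ℝ) :
    ∫ r in Ioi (0 : ℝ), r ^ lam * Real.exp (-((y ^ 2 + x ^ 2 + t ^ 2) * r)) *
      realKernel lam (2 * r * x * t) =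
    (evenMoment lam 0)⁻¹ * Real.Gamma (lam + 1) * poissonDensity lam y x t := by
  have hm := evenMoment_zero_pos hlam
  let q : ℝ → ℝ := fun s => y ^ 2 + x ^ 2 + t ^ 2 - 2 * x * t * s
  have hq (s) (hs : s ∈ Ioo (-1 : ℝ) 1) : 0 < q s := quadForm_pos hy ⟨hs.1.le, hs.2.le⟩
  have hin (s) (hs : s ∈ Ioo (-1 : ℝ) 1) : ∫ r in Ioi (0 : ℝ), r ^ lam * Real.exp (-(q s * r)) =
      Real.Gamma (lam + 1) * q s ^ (-(lam + 1)) := by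
    have h := Real.integral_rpow_mul_exp_neg_mul_Ioi (a := lam + 1) (by positivity) (hq s hs)
    rw [add_sub_cancel_right] at h
    rw [h, one_div, Real.inv_rpow (hq s hs).le, Real.rpow_neg (hq s hs).le, mul_comm]
  have hmk := measurable_dunklDensity lam
  have hint : Integrable (Function.uncurry fun s r : ℝ =>
      dunklDensity lam s * (r ^ lam * Real.exp (-(q s * r))))
      ((volume.restrict (Ioo (-1) 1)).prod (volume.restrict (Ioi 0))) := by
    rw [integrable_prod_iff (by
      refine Measurable.aestronglyMeasurable ?_
      simp only [q]
      fun_prop)]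
    constructor
    · filter_upwards [ae_restrict_mem measurableSet_Ioo] with s hs
      have := integrableOn_rpow_mul_exp_neg (a := lam + 1) (by positivity) (hq s hs)
      rw [add_sub_cancel_right] at this
      exact this.const_mul (dunklDensity lam s)
    · have hb : IntegrableOn (fun s => Real.Gamma (lam + 1) * (y ^ 2) ^ (-(lam + 1)) *
          dunklDensity lam s) (Ioo (-1) 1) := (integrableOn_dunklDensity hlam).const_mul _
      refine Integrable.mono' hb ?_ ?_
      · refine Measurable.aestronglyMeasurable ?_
        refine (StronglyMeasurable.integral_prod_right' (f := fun z : ℝ × ℝ =>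
          ‖dunklDensity lam z.1 * (z.2 ^ lam * Real.exp (-(q z.1 * z.2)))‖) ?_).measurable
        refine Measurable.stronglyMeasurable ?_
        simp only [q]
        fun_prop
      · filter_upwards [ae_restrict_mem measurableSet_Ioo] with s hs
        have h1 : ∫ r in Ioi (0 : ℝ), ‖dunklDensity lam s * (r ^ lam * Real.exp (-(q s * r)))‖ =
            dunklDensity lam s * (Real.Gamma (lam + 1) * q s ^ (-(lam + 1))) := by
          rw [← hin s hs, ← integral_const_mul]
          refine setIntegral_congr_fun measurableSet_Ioi fun r hr => ?_
          have hr : 0 < r := hr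
          have := dunklDensity_pos (lam := lam) hs
          exact Real.norm_of_nonneg (by positivity)
        have h2 := dunklDensity_pos (lam := lam) hs
        have h3 := Real.Gamma_pos_of_pos (show 0 < lam + 1 by positivity)
        have h4 := hq s hs
        simp only [Function.uncurry]
        rw [h1, Real.norm_of_nonneg (by positivity), mul_comm]
        gcongr ?_ * _
        refine mul_le_mul_of_nonneg_left ?_ h3.le
        refine Real.rpow_le_rpow_of_nonpos (by positivity) ?_ (by linarith)
        have := le_quadForm (y := y) (x := x) (t := t) ⟨hs.1.le, hs.2.le⟩
        nlinarith [sq_nonneg (|x| - |t|)]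
  have hswap := integral_integral_swap hint
  have hL : ∫ s in Ioo (-1 : ℝ) 1, ∫ r in Ioi (0 : ℝ),
      dunklDensity lam s * (r ^ lam * Real.exp (-(q s * r))) =
      Real.Gamma (lam + 1) * poissonDensity lam y x t := by
    rw [poissonDensity, ← integral_const_mul]
    refine setIntegral_congr_fun measurableSet_Ioo fun s hs => ?_
    rw [integral_const_mul, hin s hs]
    ring
  rw [mul_assoc, ← hL, hswap, ← integral_const_mul]
  refine integral_congr_ae (ae_of_all _ fun r => ?_)
  have h := integral_rexp_mul_dunklDensity hlam (2 * r * x * t)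
  rw [← realKernel] at h
  simp only
  rw [eq_comm, inv_mul_eq_iff_eq_mul₀ hm.ne', mul_left_comm, ← h, ← integral_const_mul]
  refine integral_congr_ae (ae_of_all _ fun s => ?_)
  simp only [q]
  rw [show -((y ^ 2 + x ^ 2 + t ^ 2 - 2 * x * t * s) * r) =
    -((y ^ 2 + x ^ 2 + t ^ 2) * r) + 2 * r * x * t * s by ring, Real.exp_add]
  ring

lemma one_div_four_mul_rpow_neg {s : ℝ} (hs : 0 < s) (a : ℝ) :
    (1 / (4 * s)) ^ (-a) = 4 ^ a * s ^ a := by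
  rw [one_div, Real.inv_rpow (by positivity), ← Real.rpow_neg (by positivity), neg_neg,
    Real.mul_rpow (by norm_num) hs.le]

lemma rpow_eq_rpow_neg_half_mul {s : ℝ} (hs : 0 < s) (a : ℝ) :
    s ^ a = s ^ (-(1 / 2) : ℝ) * s ^ (a + 1 / 2) := by
  rw [← Real.rpow_add hs]; congr 1; ring

/-- The explicit form of the kernel of the Poisson integral. -/
theorem dunklTranslation_poissonKernel {lam : ℝ} (hlam : 0 < lam) :
    ∃ K : ℝ, 0 < K ∧ ∀ y : ℝ, 0 < y → ∀ x t : ℝ,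
      dunklTranslation lam x (poissonKernel lam y) (-t) =
        ((K * y * poissonDensity lam y x t : ℝ) : ℂ) := by
  have hc : 0 < cConst lam := by
    have := Real.Gamma_pos_of_pos (show 0 < lam + 1 / 2 by positivity)
    unfold cConst; positivity
  have hG := Real.Gamma_pos_of_pos (show 0 < lam + 1 / 2 by positivity)
  have hG1 := Real.Gamma_pos_of_pos (show 0 < lam + 1 by positivity)
  have hm := evenMoment_zero_pos hlam
  refine ⟨cConst lam * (cConst lam * ((2 : ℝ) ^ (lam + 1 / 2) / Real.sqrt Real.pi) *
        Real.Gamma (lam + 1 / 2)) * (Real.Gamma (lam + 1 / 2) * 4 ^ (lam + 1 / 2) *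
        ((evenMoment lam 0)⁻¹ * Real.Gamma (lam + 1))), ?_, fun y hy x t => ?_⟩
  · have := Real.sqrt_pos.2 Real.pi_pos
    positivity
  have hcont (x : ℝ) : Continuous fun ξ : ℝ => dunklKernel lam (Complex.I * (x * ξ : ℝ)) :=
    (continuous_dunklKernel_I_mul hlam).comp (continuous_const.mul continuous_id)
  have h := integral_gaussian_mixture_mul hlam
    (φ := fun s => s ^ (-(1 / 2) : ℝ) * Real.exp (-(y ^ 2 * s))) (b := fun s => 1 / (4 * s))
    (g := fun ξ => dunklKernel lam (Complex.I * ((-t * ξ : ℝ) : ℂ)) *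
      dunklKernel lam (Complex.I * ((x * ξ : ℝ) : ℂ))) (by fun_prop) (fun s hs => by positivity) (by fun_prop) (fun s hs => by positivity) ?_
    ((hcont (-t)).mul (hcont x)) (fun ξ => by
      rw [norm_mul]
      exact mul_le_one₀ (norm_dunklKernel_I_mul_le hlam _) (norm_nonneg _)
        (norm_dunklKernel_I_mul_le hlam _))
  · rw [dunklTranslation]
    simp_rw [dunklTransform_poissonKernel hlam hy]
    have e (ξ : ℝ) (A B : ℂ) : A * B * dunklKernel lam (Complex.I * ((-t : ℝ) : ℂ) * ξ) *
        dunklKernel lam (Complex.I * x * ξ) * (weight lam ξ : ℂ) =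
        A * (B * (dunklKernel lam (Complex.I * ((-t * ξ : ℝ) : ℂ)) *
          dunklKernel lam (Complex.I * ((x * ξ : ℝ) : ℂ))) * (weight lam ξ : ℂ)) := by
      rw [Complex.ofReal_mul, Complex.ofReal_mul, mul_assoc Complex.I, mul_assoc Complex.I]
      ring
    simp_rw [e]
    rw [integral_const_mul, h]
    have e2 : ∫ s in Ioi (0 : ℝ), ((s ^ (-(1 / 2) : ℝ) * Real.exp (-(y ^ 2 * s)) : ℝ) : ℂ) *
        ∫ ξ : ℝ, ((Real.exp (-(1 / (4 * s)) * ξ ^ 2) * weight lam ξ : ℝ) : ℂ) *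
          (dunklKernel lam (Complex.I * ((-t * ξ : ℝ) : ℂ)) *
          dunklKernel lam (Complex.I * ((x * ξ : ℝ) : ℂ))) =
        ∫ s in Ioi (0 : ℝ), ((Real.Gamma (lam + 1 / 2) * 4 ^ (lam + 1 / 2) *
          (s ^ lam * Real.exp (-((y ^ 2 + x ^ 2 + t ^ 2) * s)) *
            realKernel lam (2 * s * x * t)) : ℝ) : ℂ) := by
      refine setIntegral_congr_fun measurableSet_Ioi fun s hs => ?_
      have hs : 0 < s := hs
      rw [integral_gaussian_mul_dunklKernel hlam (show 0 < 1 / (4 * s) by positivity) (-t) x,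
        ← Complex.ofReal_mul, one_div_four_mul_rpow_neg hs, rpow_eq_rpow_neg_half_mul hs lam,
        show -((y ^ 2 + x ^ 2 + t ^ 2) * s) =
          -(y ^ 2 * s) + -((-t) ^ 2 + x ^ 2) / (4 * (1 / (4 * s))) by field_simp; ring,
        Real.exp_add, show -(-t * x) / (2 * (1 / (4 * s))) = 2 * s * x * t by field_simp; ring]
      congr 1
      ring
    rw [e2, integral_complex_ofReal, integral_const_mul,
      integral_rpow_mul_exp_mul_realKernel hlam hy]
    push_cast
    ring
  · have hi := integrableOn_rpow_mul_exp_neg (a := lam + 1) (r := y ^ 2) (by positivity)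
      (by positivity)
    refine IntegrableOn.congr_fun (hi.const_mul (4 ^ (lam + 1 / 2))) (fun s hs => ?_)
      measurableSet_Ioi
    have hs : 0 < s := hs
    rw [one_div_four_mul_rpow_neg hs, add_sub_cancel_right, rpow_eq_rpow_neg_half_mul hs lam]
    ring

/-! ### Size of the kernel -/

lemma integrableOn_kernelProfile {lam P b : ℝ} (hlam : 0 < lam) (hP : 0 < P) (hb : 0 ≤ b) :
    IntegrableOn (fun s : ℝ => (1 - s) ^ (lam - 1) * (P + b * (1 - s)) ^ (-(lam + 1)))
      (Ioo (-1) 1) := by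
  refine Integrable.mul_bdd (c := P ^ (-(lam + 1))) (integrableOn_one_sub_rpow hlam)
    (Measurable.aestronglyMeasurable (by fun_prop)) ?_
  filter_upwards [ae_restrict_mem measurableSet_Ioo] with s hs
  have h2 : 0 < 1 - s := by linarith [hs.2]
  rw [Real.norm_of_nonneg (by positivity)]
  exact Real.rpow_le_rpow_of_nonpos hP (by nlinarith) (by linarith)

/-- The integrand has an explicit primitive, because the derivative of `(1-s)/(P+b(1-s))` is
`-P/(P+b(1-s))²`. -/
lemma integral_kernelProfile {lam P b : ℝ} (hlam : 0 < lam) (hP : 0 < P) (hb : 0 ≤ b) :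
    ∫ s in Ioo (-1 : ℝ) 1, (1 - s) ^ (lam - 1) * (P + b * (1 - s)) ^ (-(lam + 1)) =
      (lam * P)⁻¹ * (2 / (P + 2 * b)) ^ lam := by
  have hpos (s : ℝ) (hs : s ∈ Icc (-1 : ℝ) 1) : 0 < P + b * (1 - s) := by
    have : 0 ≤ 1 - s := by linarith [hs.2]
    positivity
  have h := intervalIntegral.integral_eq_sub_of_hasDerivAt_of_le (a := -1) (b := 1)
    (f := fun s : ℝ => -((lam * P)⁻¹ * ((1 - s) / (P + b * (1 - s))) ^ lam)) (by norm_num)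
    ?_ (f' := fun s : ℝ => (1 - s) ^ (lam - 1) * (P + b * (1 - s)) ^ (-(lam + 1)))
    (fun s hs => ?_) ((intervalIntegrable_iff_integrableOn_Ioo_of_le (by norm_num)).2
      (integrableOn_kernelProfile hlam hP hb))
  · rw [intervalIntegral.integral_of_le (by norm_num), integral_Ioc_eq_integral_Ioo] at h
    rw [h]
    norm_num [Real.zero_rpow hlam.ne']
    left
    rw [mul_comm b 2]
  · refine ContinuousOn.neg (ContinuousOn.mul continuousOn_const (ContinuousOn.rpow_const
      (ContinuousOn.div (by fun_prop) (by fun_prop) fun s hs => (hpos s hs).ne')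
      fun s hs => Or.inr hlam.le))
  · have hq := hpos s ⟨hs.1.le, hs.2.le⟩
    have h2 : 0 < 1 - s := by linarith [hs.2]
    have hd1 : HasDerivAt (fun s : ℝ => 1 - s) (-1) s := by
      simpa using (hasDerivAt_id s).const_sub 1
    have hd2 : HasDerivAt (fun s : ℝ => P + b * (1 - s)) (b * -1) s :=
      (hd1.const_mul b).const_add P
    refine ((((hd1.div hd2 hq.ne').rpow_const (p := lam)
      (Or.inl (div_pos h2 hq).ne')).const_mul (lam * P)⁻¹).neg).congr_deriv ?_
    simp only [Pi.div_apply]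
    have e : (P + b * (1 - s)) ^ (-(lam + 1)) =
        ((P + b * (1 - s)) ^ (lam - 1))⁻¹ * ((P + b * (1 - s)) ^ 2)⁻¹ := by
      rw [show -(lam + 1) = -(lam - 1) - (2 : ℕ) by push_cast; ring, Real.rpow_sub hq,
        Real.rpow_natCast, Real.rpow_neg hq.le, div_eq_mul_inv]
    rw [Real.div_rpow h2.le hq.le, e]
    have : 0 < (P + b * (1 - s)) ^ (lam - 1) := by positivity
    field_simp
    ring

lemma integrableOn_dunklDensity_mul_rpow {lam y : ℝ} (hlam : 0 < lam) (hy : 0 < y) (x t : ℝ) :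
    IntegrableOn (fun s => dunklDensity lam s *
      (y ^ 2 + x ^ 2 + t ^ 2 - 2 * x * t * s) ^ (-(lam + 1))) (Ioo (-1) 1) := by
  refine Integrable.mul_bdd (c := (y ^ 2) ^ (-(lam + 1))) (integrableOn_dunklDensity hlam)
    (Measurable.aestronglyMeasurable (by fun_prop)) ?_
  filter_upwards [ae_restrict_mem measurableSet_Ioo] with s hs
  have hs' : s ∈ Icc (-1 : ℝ) 1 := ⟨hs.1.le, hs.2.le⟩
  have hq := quadForm_pos (x := x) (t := t) hy hs'
  rw [Real.norm_of_nonneg (by positivity)]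
  refine Real.rpow_le_rpow_of_nonpos (by positivity) ?_ (by linarith)
  nlinarith [le_quadForm (y := y) (x := x) (t := t) hs', sq_nonneg (|x| - |t|)]

lemma poissonDensity_nonneg {lam y : ℝ} (hy : 0 < y) (x t : ℝ) : 0 ≤ poissonDensity lam y x t := by
  refine setIntegral_nonneg measurableSet_Ioo fun s hs => ?_
  have hq := quadForm_pos (x := x) (t := t) hy ⟨hs.1.le, hs.2.le⟩
  have := dunklDensity_pos (lam := lam) hs
  positivity

/-- The minimum of the quadratic form sits at `s = 1` when `x t ≥ 0`, and `integral_kernelProfile`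
applies. When `x t ≤ 0` it sits at `s = -1`, where the factor `(1+s)^lam` of the density
compensates: `(1+s)/(P+b(1+s))` increases in `s`. -/
lemma poissonDensity_le {lam y : ℝ} (hlam : 0 < lam) (hy : 0 < y) (x t : ℝ) :
    poissonDensity lam y x t ≤ 2 ^ lam * ((lam * (y ^ 2 + (|x| - |t|) ^ 2))⁻¹ *
      (2 / (y ^ 2 + (|x| + |t|) ^ 2)) ^ lam) := by
  set P := y ^ 2 + (|x| - |t|) ^ 2 with hPdef
  have hP : 0 < P := by positivity
  set b := 2 * (|x| * |t|) with hbdef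
  have hb : 0 ≤ b := by positivity
  have hPb : y ^ 2 + (|x| + |t|) ^ 2 = P + 2 * b := by rw [hPdef, hbdef]; ring
  have hI := integrableOn_dunklDensity_mul_rpow hlam hy x t
  rw [hPb]
  rcases le_total 0 (x * t) with hxt | hxt
  · have hq (s : ℝ) : y ^ 2 + x ^ 2 + t ^ 2 - 2 * x * t * s = P + b * (1 - s) := by
      rw [hPdef, hbdef, ← abs_mul, abs_of_nonneg hxt, sub_sq, sq_abs, sq_abs,
        mul_assoc 2 |x|, ← abs_mul, abs_of_nonneg hxt]
      ring
    rw [← integral_kernelProfile hlam hP hb, ← integral_const_mul]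
    refine setIntegral_mono_on hI ((integrableOn_kernelProfile hlam hP hb).const_mul _)
      measurableSet_Ioo fun s hs => ?_
    have h2 : 0 < 1 - s := by linarith [hs.2]
    rw [hq, ← mul_assoc]
    gcongr
    exact dunklDensity_le hlam hs
  · have hq (s : ℝ) : y ^ 2 + x ^ 2 + t ^ 2 - 2 * x * t * s = P + b * (1 + s) := by
      rw [hPdef, hbdef, ← abs_mul, abs_of_nonpos hxt, sub_sq, sq_abs, sq_abs,
        mul_assoc 2 |x|, ← abs_mul, abs_of_nonpos hxt]
      ring
    have h1 : ∫ s in Ioo (-1 : ℝ) 1, (1 - s) ^ (lam - 1) = lam⁻¹ * 2 ^ lam := by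
      have := integral_kernelProfile hlam one_pos le_rfl
      simpa using this
    have h2 : 2 ^ lam * ((lam * P)⁻¹ * (2 / (P + 2 * b)) ^ lam) =
        ∫ s in Ioo (-1 : ℝ) 1, P⁻¹ * (2 / (P + 2 * b)) ^ lam * (1 - s) ^ (lam - 1) := by
      rw [integral_const_mul, h1, mul_inv]; ring
    rw [h2]
    refine setIntegral_mono_on hI ((integrableOn_one_sub_rpow hlam).const_mul _)
      measurableSet_Ioo fun s hs => ?_
    have h3 : 0 < 1 - s := by linarith [hs.2]
    have h4 : 0 < 1 + s := by linarith [hs.1]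
    have h5 : 0 < P + b * (1 + s) := by positivity
    rw [hq, dunklDensity_eq hs, neg_add, Real.rpow_add h5, Real.rpow_neg_one,
      Real.rpow_neg h5.le]
    calc (1 + s) ^ lam * (1 - s) ^ (lam - 1) * (((P + b * (1 + s)) ^ lam)⁻¹ * (P + b * (1 + s))⁻¹)
        = (P + b * (1 + s))⁻¹ * ((1 + s) / (P + b * (1 + s))) ^ lam * (1 - s) ^ (lam - 1) := by
          rw [Real.div_rpow h4.le h5.le]; ring
      _ ≤ P⁻¹ * (2 / (P + 2 * b)) ^ lam * (1 - s) ^ (lam - 1) := by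
          have e1 : (P + b * (1 + s))⁻¹ ≤ P⁻¹ := by
            gcongr
            nlinarith
          have e2 : (1 + s) / (P + b * (1 + s)) ≤ 2 / (P + 2 * b) := by
            rw [div_le_div_iff₀ h5 (by positivity)]
            nlinarith [hs.2]
          gcongr

lemma poissonDensity_le_rpow {lam y : ℝ} (hlam : 0 < lam) (hy : 0 < y) {x t : ℝ}
    (hxt : 0 < |x| + |t|) :
    poissonDensity lam y x t ≤ 2 ^ lam * 2 ^ lam / lam * (y ^ 2 + (|x| - |t|) ^ 2)⁻¹ *
      (|x| + |t|) ^ (-(2 * lam)) := by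
  refine (poissonDensity_le hlam hy x t).trans ?_
  have h1 : (2 / (y ^ 2 + (|x| + |t|) ^ 2)) ^ lam ≤ 2 ^ lam * (|x| + |t|) ^ (-(2 * lam)) := by
    rw [Real.div_rpow two_pos.le (by positivity), Real.rpow_neg hxt.le, ← div_eq_mul_inv,
      Real.rpow_mul hxt.le, Real.rpow_two]
    gcongr
    nlinarith
  calc _ ≤ 2 ^ lam * ((lam * (y ^ 2 + (|x| - |t|) ^ 2))⁻¹ *
        (2 ^ lam * (|x| + |t|) ^ (-(2 * lam)))) := by gcongr
    _ = _ := by rw [mul_inv]; ring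

/-- The factor `(|x| + |t|)^(-2 lam)` absorbs the weight, and `(|x| - |t|)²` is one of `(t - x)²`,
`(t + x)²`. The two Cauchy kernels have mass `π` for every `y`, whence the uniform sup bound. -/
lemma mul_poissonDensity_mul_weight_le {lam y : ℝ} (hlam : 0 < lam) (hy : 0 < y) (x t : ℝ) :
    y * poissonDensity lam y x t * weight lam t ≤
      2 ^ lam * 2 ^ lam / lam * (y / (y ^ 2 + (t - x) ^ 2) + y / (y ^ 2 + (t + x) ^ 2)) := by
  rcases eq_or_ne t 0 with rfl | ht
  · have : weight lam 0 = 0 := by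
      rw [weight, abs_zero, Real.zero_rpow (by positivity)]
    rw [this, mul_zero]
    positivity
  have ht' : 0 < |t| := abs_pos.2 ht
  have hxt : 0 < |x| + |t| := by positivity
  have h1 : (|x| + |t|) ^ (-(2 * lam)) * weight lam t ≤ 1 := by
    rw [Real.rpow_neg hxt.le, inv_mul_le_one₀ (by positivity), weight]
    gcongr
    linarith [abs_nonneg x]
  have h2 : y * (y ^ 2 + (|x| - |t|) ^ 2)⁻¹ ≤
      y / (y ^ 2 + (t - x) ^ 2) + y / (y ^ 2 + (t + x) ^ 2) := by
    have p1 : 0 ≤ y / (y ^ 2 + (t - x) ^ 2) := by positivity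
    have p2 : 0 ≤ y / (y ^ 2 + (t + x) ^ 2) := by positivity
    rw [← div_eq_mul_inv]
    rcases abs_choice x with hx | hx <;> rcases abs_choice t with ht | ht <;> rw [hx, ht]
    · rw [show (x - t) ^ 2 = (t - x) ^ 2 by ring]; linarith
    · rw [show (x - -t) ^ 2 = (t + x) ^ 2 by ring]; linarith
    · rw [show (-x - t) ^ 2 = (t + x) ^ 2 by ring]; linarith
    · rw [show (-x - -t) ^ 2 = (t - x) ^ 2 by ring]; linarith
  calc y * poissonDensity lam y x t * weight lam t
      ≤ y * (2 ^ lam * 2 ^ lam / lam * (y ^ 2 + (|x| - |t|) ^ 2)⁻¹ *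
          (|x| + |t|) ^ (-(2 * lam))) * weight lam t := by
        have := weight_nonneg lam t
        gcongr
        exact poissonDensity_le_rpow hlam hy hxt
    _ = 2 ^ lam * 2 ^ lam / lam * (y * (y ^ 2 + (|x| - |t|) ^ 2)⁻¹) *
          ((|x| + |t|) ^ (-(2 * lam)) * weight lam t) := by ring
    _ ≤ 2 ^ lam * 2 ^ lam / lam * (y * (y ^ 2 + (|x| - |t|) ^ 2)⁻¹) * 1 := by gcongr
    _ ≤ _ := by rw [mul_one]; gcongr

/-! ### Cauchy kernels and the sup bound -/

lemma cauchyKernel_eq {y : ℝ} (hy : 0 < y) (c t : ℝ) :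
    y / (y ^ 2 + (t + c) ^ 2) = y⁻¹ * (1 + (t / y + c / y) ^ 2)⁻¹ := by
  rw [← add_div, div_pow, ← mul_inv, div_eq_mul_inv, eq_comm, inv_eq_iff_eq_inv]
  field_simp

lemma integrable_cauchyKernel {y : ℝ} (hy : 0 < y) (c : ℝ) :
    Integrable fun t : ℝ => y / (y ^ 2 + (t + c) ^ 2) := by
  simp_rw [cauchyKernel_eq hy]
  exact ((integrable_inv_one_add_sq.comp_add_right (c / y)).comp_div hy.ne').const_mul _

lemma integral_cauchyKernel {y : ℝ} (hy : 0 < y) (c : ℝ) :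
    ∫ t : ℝ, y / (y ^ 2 + (t + c) ^ 2) = Real.pi := by
  simp_rw [cauchyKernel_eq hy]
  rw [integral_const_mul,
    Measure.integral_comp_div (fun t : ℝ => (1 + (t + c / y) ^ 2)⁻¹) y,
    integral_add_right_eq_self (fun t : ℝ => (1 + t ^ 2)⁻¹), integral_univ_inv_one_add_sq,
    abs_of_pos hy, smul_eq_mul, inv_mul_cancel_left₀ hy.ne']

lemma measurable_uncurry_poissonDensity (lam y : ℝ) :
    Measurable fun z : ℝ × ℝ => poissonDensity lam y z.1 z.2 := by
  have hmk := measurable_dunklDensity lam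
  refine (StronglyMeasurable.integral_prod_right' (ν := volume.restrict (Ioo (-1 : ℝ) 1))
    (f := fun z : (ℝ × ℝ) × ℝ => dunklDensity lam z.2 *
    (y ^ 2 + z.1.1 ^ 2 + z.1.2 ^ 2 - 2 * z.1.1 * z.1.2 * z.2) ^ (-(lam + 1))) ?_).measurable
  refine Measurable.stronglyMeasurable ?_
  fun_prop

theorem poissonIntegral_eq {lam : ℝ} (hlam : 0 < lam) :
    ∃ K : ℝ, 0 < K ∧ ∀ (a : ℝ → ℂ) (y : ℝ), 0 < y → ∀ x : ℝ,
      poissonIntegral lam a y x = (K : ℂ) *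
        ((y : ℂ) * ∫ t : ℝ, a t * (poissonDensity lam y x t : ℂ) * (weight lam t : ℂ)) := by
  obtain ⟨K, hK, h⟩ := dunklTranslation_poissonKernel hlam
  have hc : 0 < cConst lam := by
    have := Real.Gamma_pos_of_pos (show 0 < lam + 1 / 2 by positivity)
    unfold cConst; positivity
  refine ⟨cConst lam * K, by positivity, fun a y hy x => ?_⟩
  rw [poissonIntegral, dunklConv]
  simp_rw [h y hy x]
  have e (t : ℝ) : a t * ((K * y * poissonDensity lam y x t : ℝ) : ℂ) * (weight lam t : ℂ) =
      ((K : ℂ) * y) * (a t * (poissonDensity lam y x t : ℂ) * (weight lam t : ℂ)) := by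
    push_cast; ring
  simp_rw [e]
  rw [integral_const_mul]
  push_cast
  ring

/-- The Poisson integral is bounded on `L^∞`, uniformly in `y`. -/
lemma norm_integral_mul_poissonDensity_le {lam : ℝ} (hlam : 0 < lam) {M : ℝ} (hM : 0 ≤ M)
    {a : ℝ → ℂ} (ha : ∀ᵐ t, ‖a t‖ ≤ M) {y : ℝ} (hy : 0 < y) (x : ℝ) :
    ‖(y : ℂ) * ∫ t : ℝ, a t * (poissonDensity lam y x t : ℂ) * (weight lam t : ℂ)‖ ≤
      2 ^ lam * 2 ^ lam / lam * (2 * Real.pi) * M := by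
  have hint := (integrable_cauchyKernel hy (-x)).add (integrable_cauchyKernel hy x)
  rw [← integral_const_mul]
  refine (norm_integral_le_of_norm_le (hint.const_mul (2 ^ lam * 2 ^ lam / lam * M)) ?_).trans
    (le_of_eq ?_)
  · filter_upwards [ha] with t ht
    have h1 := mul_poissonDensity_mul_weight_le hlam hy x t
    have h2 := poissonDensity_nonneg (lam := lam) hy x t
    have h3 := weight_nonneg lam t
    rw [norm_mul, norm_mul, norm_mul, Complex.norm_real, Complex.norm_real, Complex.norm_real,
      Real.norm_of_nonneg hy.le, Real.norm_of_nonneg h2, Real.norm_of_nonneg h3]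
    calc y * (‖a t‖ * poissonDensity lam y x t * weight lam t)
        = ‖a t‖ * (y * poissonDensity lam y x t * weight lam t) := by ring
      _ ≤ M * (2 ^ lam * 2 ^ lam / lam *
            (y / (y ^ 2 + (t - x) ^ 2) + y / (y ^ 2 + (t + x) ^ 2))) := by gcongr
      _ = _ := by simp only [Pi.add_apply, sub_eq_add_neg]; ring
  · rw [integral_const_mul]
    have := integral_add (integrable_cauchyKernel hy (-x)) (integrable_cauchyKernel hy x)
    simp only [Pi.add_apply] at this ⊢
    rw [this, integral_cauchyKernel hy, integral_cauchyKernel hy]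
    ring

/-! ### Taylor approximation and vanishing moments -/

/-- Taylor approximation of `(1 + u) ^ a` at `0`. -/
lemma exists_taylor_one_add_rpow (a : ℝ) (N : ℕ) :
    ∃ (c : ℕ → ℝ) (C : ℝ), 0 < C ∧ ∀ u : ℝ, |u| ≤ 9 / 16 →
      |(1 + u) ^ a - ∑ i ∈ Finset.range (N + 1), c i * u ^ i| ≤ C * |u| ^ (N + 1) := by
  have hps := Real.one_add_rpow_hasFPowerSeriesOnBall_zero (a := a)
  -- Any radius strictly between `9/16` and `1` serves. The range `9/16 = (9/4)(1/4)` is what `4δ ≤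
  -- D` gives for the relative increment of the quadratic form.
  have hr : ((3 / 4 : NNReal) : ENNReal) < 1 := by
    rw [← ENNReal.coe_one, ENNReal.coe_lt_coe, ← NNReal.coe_lt_coe]; norm_num
  obtain ⟨ρ, hρ, C, hC, h⟩ := hps.uniform_geometric_approx' hr
  refine ⟨fun i => (binomialSeries ℝ a).coeff i, C * (ρ * (4 / 3)) ^ (N + 1), ?_, fun u hu => ?_⟩
  · have := hρ.1
    positivity
  · have hmem : u ∈ Metric.ball (0 : ℝ) ((3 / 4 : NNReal) : ℝ) := by
      rw [Metric.mem_ball, dist_zero_right, Real.norm_eq_abs]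
      push_cast
      linarith
    have h1 := h u hmem (N + 1)
    rw [zero_add, Real.norm_eq_abs, Real.norm_eq_abs, FormalMultilinearSeries.partialSum] at h1
    simp only [FormalMultilinearSeries.apply_eq_pow_smul_coeff, smul_eq_mul] at h1
    simp only [mul_comm _ (u ^ _)]
    refine h1.trans (le_of_eq ?_)
    push_cast
    rw [mul_assoc, ← mul_pow]
    congr 2
    ring

section Moments

variable {lam x₀ δ M : ℝ} {a : ℝ → ℂ}

lemma integrable_of_bdd_of_support (hm : AEMeasurable a) (ha : ∀ᵐ t, ‖a t‖ ≤ M)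
    (hs : ∀ᵐ t, t ∉ Metric.ball x₀ δ → a t = 0) : Integrable a := by
  have hi : Integrable ((Metric.ball x₀ δ).indicator fun _ : ℝ => M) :=
    (integrable_indicator_iff measurableSet_ball).2 (integrableOn_const measure_ball_lt_top.ne)
  refine hi.mono' hm.aestronglyMeasurable ?_
  filter_upwards [ha, hs] with t h1 h2
  by_cases ht : t ∈ Metric.ball x₀ δ
  · rwa [indicator_of_mem ht]
  · rw [indicator_of_notMem ht, h2 ht, norm_zero]

lemma integrable_continuous_mul_of_support (hm : AEMeasurable a) (ha : ∀ᵐ t, ‖a t‖ ≤ M)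
    (hs : ∀ᵐ t, t ∉ Metric.ball x₀ δ → a t = 0) {g : ℝ → ℂ} (hg : Continuous g) :
    Integrable fun t => g t * a t := by
  obtain ⟨B, hB⟩ := (isCompact_closedBall x₀ δ).exists_bound_of_continuousOn hg.continuousOn
  have hi := integrable_of_bdd_of_support hm ha hs
  refine (hi.norm.const_mul B).mono' (hg.aestronglyMeasurable.mul hi.aestronglyMeasurable) ?_
  filter_upwards [hs] with t h2
  rw [norm_mul]
  by_cases ht : t ∈ Metric.ball x₀ δ
  · exact mul_le_mul_of_nonneg_right (hB t (Metric.ball_subset_closedBall ht)) (norm_nonneg _)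
  · simp [h2 ht]

lemma integral_polynomial_mul_eq_zero (hlam : 0 < lam) (hm : AEMeasurable a)
    (ha : ∀ᵐ t, ‖a t‖ ≤ M) (hs : ∀ᵐ t, t ∉ Metric.ball x₀ δ → a t = 0) {κ : ℕ}
    (hmom : ∀ k : ℕ, k ≤ κ → ∫ t : ℝ, (t : ℂ) ^ k * a t * (weight lam t : ℂ) = 0)
    (p : Polynomial ℝ) (hp : p.natDegree ≤ κ) :
    ∫ t : ℝ, ((p.eval t : ℝ) : ℂ) * (a t * (weight lam t : ℂ)) = 0 := by
  have e (t : ℝ) : ((p.eval t : ℝ) : ℂ) * (a t * (weight lam t : ℂ)) =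
      ∑ k ∈ Finset.range (κ + 1),
        (p.coeff k : ℂ) * ((t : ℂ) ^ k * a t * (weight lam t : ℂ)) := by
    rw [Polynomial.eval_eq_sum_range' (Nat.lt_succ_iff.2 hp)]
    push_cast
    rw [Finset.sum_mul]
    exact Finset.sum_congr rfl fun k _ => by ring
  simp_rw [e]
  rw [integral_finsetSum]
  · refine Finset.sum_eq_zero fun k hk => ?_
    rw [integral_const_mul, hmom k (Nat.lt_succ_iff.1 (Finset.mem_range.1 hk)), mul_zero]
  · intro k _
    have hw := continuous_weight hlam
    have := integrable_continuous_mul_of_support hm ha hs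
      (g := fun t : ℝ => (t : ℂ) ^ k * (weight lam t : ℂ)) (by fun_prop)
    refine (this.const_mul (p.coeff k : ℂ)).congr (ae_of_all _ fun t => ?_)
    simp only
    ring

lemma norm_integral_mul_le_intervalMass (hlam : 0 < lam) (ha : ∀ᵐ t, ‖a t‖ ≤ M)
    (hs : ∀ᵐ t, t ∉ Metric.ball x₀ δ → a t = 0) {F : ℝ → ℝ} {B : ℝ}
    (hF : ∀ t ∈ Metric.ball x₀ δ, |F t| ≤ B) :
    ‖∫ t : ℝ, (F t : ℂ) * (a t * (weight lam t : ℂ))‖ ≤ B * M * intervalMass lam x₀ δ := by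
  have hw := ((continuous_weight hlam).locallyIntegrable (μ := volume)).integrableOn_isCompact
    (isCompact_closedBall x₀ δ) |>.mono_set Metric.ball_subset_closedBall
  have hi : Integrable ((Metric.ball x₀ δ).indicator fun t => B * M * weight lam t) :=
    (integrable_indicator_iff measurableSet_ball).2 (hw.const_mul _)
  refine (norm_integral_le_of_norm_le hi ?_).trans (le_of_eq ?_)
  · filter_upwards [ha, hs] with t h1 h2
    by_cases ht : t ∈ Metric.ball x₀ δ
    · rw [indicator_of_mem ht, norm_mul, norm_mul, Complex.norm_real, Complex.norm_real,
        Real.norm_of_nonneg (weight_nonneg _ _), Real.norm_eq_abs, ← mul_assoc]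
      have h3 := hF t ht
      have h4 := weight_nonneg lam t
      have h5 : 0 ≤ B := (abs_nonneg _).trans h3
      gcongr
    · simp [indicator_of_notMem ht, h2 ht]
  · rw [integral_indicator measurableSet_ball, integral_const_mul, intervalMass]

end Moments

/-- The kernel profile `q ^ (-lam - 1)` is approximated by polynomials in `t` of degree `2 N`, with
an error of order `N + 1` in the relative size of the interval. -/
lemma exists_polynomial_approx_quadForm (lam : ℝ) (N : ℕ) :
    ∃ C : ℝ, 0 < C ∧ ∀ y x x₀ δ s : ℝ, 0 < y → 0 < δ → 4 * δ ≤ |(|x| - |x₀|)| →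
      s ∈ Icc (-1 : ℝ) 1 → ∃ p : Polynomial ℝ, p.natDegree ≤ 2 * N ∧
      ∀ t ∈ Metric.ball x₀ δ,
        |(y ^ 2 + x ^ 2 + t ^ 2 - 2 * x * t * s) ^ (-(lam + 1)) - p.eval t| ≤
          C * (δ / |(|x| - |x₀|)|) ^ (N + 1) *
            (y ^ 2 + x ^ 2 + x₀ ^ 2 - 2 * x * x₀ * s) ^ (-(lam + 1)) := by
  obtain ⟨c, C, hC, hT⟩ := exists_taylor_one_add_rpow (-(lam + 1)) N
  refine ⟨C * (9 / 4) ^ (N + 1), by positivity, fun y x x₀ δ s hy hδ hD hs => ?_⟩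
  set D := |(|x| - |x₀|)| with hDdef
  have hD0 : 0 < D := by linarith
  set q₀ := y ^ 2 + x ^ 2 + x₀ ^ 2 - 2 * x * x₀ * s with hq₀
  have hq₀pos : 0 < q₀ := quadForm_pos hy hs
  have hDq : D ^ 2 ≤ q₀ := by
    have := le_quadForm (y := y) (x := x) (t := x₀) hs
    rw [hDdef, sq_abs]; nlinarith
  have hs2 : s ^ 2 ≤ 1 := (sq_le_one_iff_abs_le_one s).2 (abs_le.2 hs)
  -- Completing the square, `q₀ = y² + (x₀ - xs)² + x²(1 - s²)`.
  have hlin : |x₀ - x * s| ≤ √q₀ := by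
    refine Real.abs_le_sqrt ?_
    rw [hq₀]
    nlinarith [sq_nonneg y, mul_nonneg (sq_nonneg x) (sub_nonneg.2 hs2)]
  have hDs : D ≤ √q₀ := Real.le_sqrt_of_sq_le hDq
  have hsq : √q₀ * √q₀ = q₀ := Real.mul_self_sqrt hq₀pos.le
  -- `w` is the relative increment `(q(t) - q₀)/q₀`. It is quadratic in `t`, so order `N` in `w`
  -- costs degree `2N`.
  let w : Polynomial ℝ := Polynomial.C (2 * (x₀ - x * s) / q₀) *
    (Polynomial.X - Polynomial.C x₀) + Polynomial.C q₀⁻¹ * (Polynomial.X - Polynomial.C x₀) ^ 2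
  have hw : w.natDegree ≤ 2 := by simp only [w]; compute_degree
  refine ⟨Polynomial.C (q₀ ^ (-(lam + 1))) *
    ∑ i ∈ Finset.range (N + 1), Polynomial.C (c i) * w ^ i, ?_, fun t ht => ?_⟩
  · refine (Polynomial.natDegree_C_mul_le _ _).trans ?_
    refine Polynomial.natDegree_sum_le_of_forall_le _ _ fun i hi => ?_
    refine (Polynomial.natDegree_C_mul_le _ _).trans (Polynomial.natDegree_pow_le.trans ?_)
    have := Finset.mem_range.1 hi
    nlinarith
  · set u := w.eval t with hu
    have hu' : u = (t - x₀) * (2 * (x₀ - x * s) + (t - x₀)) / q₀ := by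
      simp only [hu, w, Polynomial.eval_add, Polynomial.eval_mul, Polynomial.eval_C,
        Polynomial.eval_sub, Polynomial.eval_X, Polynomial.eval_pow]
      field_simp
    have hq : y ^ 2 + x ^ 2 + t ^ 2 - 2 * x * t * s = q₀ * (1 + u) := by
      rw [hu', mul_add, mul_div_cancel₀ _ hq₀pos.ne', hq₀]; ring
    have hh : |t - x₀| ≤ δ := by
      rw [← Real.dist_eq]; exact (Metric.mem_ball.1 ht).le
    have hub : |u| ≤ 9 / 4 * (δ / D) := by
      -- `9/4 = 2 + 1/4`, the last term coming from `|t - x₀| ≤ δ ≤ D/4 ≤ √q₀/4`.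
      have h1 : |2 * (x₀ - x * s) + (t - x₀)| ≤ 9 / 4 * √q₀ := by
        refine (abs_add_le _ _).trans ?_
        rw [abs_mul, abs_two]
        linarith
      rw [hu', abs_div, abs_mul, abs_of_pos hq₀pos]
      calc |t - x₀| * |2 * (x₀ - x * s) + (t - x₀)| / q₀ ≤ δ * (9 / 4 * √q₀) / q₀ := by gcongr
        _ = 9 / 4 * (δ / √q₀) := by
          have : 0 < √q₀ := Real.sqrt_pos.2 hq₀pos
          nth_rewrite 2 [← hsq]
          field_simp
        _ ≤ 9 / 4 * (δ / D) := by gcongr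
    have hδD : δ / D ≤ 1 / 4 := by
      rw [div_le_iff₀ hD0]; linarith
    have hu1 : |u| ≤ 9 / 16 := by linarith
    have hu2 : 0 < 1 + u := by linarith [(abs_le.1 hu1).1]
    have hT' := hT u hu1
    have heval : (Polynomial.C (q₀ ^ (-(lam + 1))) *
        ∑ i ∈ Finset.range (N + 1), Polynomial.C (c i) * w ^ i).eval t =
        q₀ ^ (-(lam + 1)) * ∑ i ∈ Finset.range (N + 1), c i * u ^ i := by
      simp [Polynomial.eval_finsetSum, hu]
    rw [heval, hq, Real.mul_rpow hq₀pos.le hu2.le, ← mul_sub, abs_mul,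
      abs_of_pos (Real.rpow_pos_of_pos hq₀pos _), mul_comm]
    refine mul_le_mul_of_nonneg_right (hT'.trans ?_) (Real.rpow_pos_of_pos hq₀pos _).le
    rw [mul_assoc, ← mul_pow]
    gcongr

/-- For each fixed `s` the approximating polynomial may be subtracted at no cost. The remaining
error is proportional to the power of `q` at `t = x₀`, so averaging over `s` restores
`poissonDensity` at `x₀`. -/
lemma norm_integral_mul_poissonDensity_le_of_moments {lam : ℝ} (hlam : 0 < lam) (N : ℕ) :
    ∃ C : ℝ, 0 < C ∧ ∀ (a : ℝ → ℂ) (M x₀ δ : ℝ) (κ : ℕ), 2 * N ≤ κ → AEMeasurable a → 0 < δ →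
      (∀ᵐ t, ‖a t‖ ≤ M) → (∀ᵐ t, t ∉ Metric.ball x₀ δ → a t = 0) →
      (∀ k : ℕ, k ≤ κ → ∫ t : ℝ, (t : ℂ) ^ k * a t * (weight lam t : ℂ) = 0) →
      ∀ y x : ℝ, 0 < y → 4 * δ ≤ |(|x| - |x₀|)| →
      ‖∫ t : ℝ, a t * (poissonDensity lam y x t : ℂ) * (weight lam t : ℂ)‖ ≤
        C * (δ / |(|x| - |x₀|)|) ^ (N + 1) * M * intervalMass lam x₀ δ *
          poissonDensity lam y x x₀ := by
  obtain ⟨C, hC, happ⟩ := exists_polynomial_approx_quadForm lam N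
  refine ⟨C, hC, fun a M x₀ δ κ hκ hm hδ ha hs hmom y x hy hD => ?_⟩
  let q : ℝ → ℝ → ℝ := fun t s => y ^ 2 + x ^ 2 + t ^ 2 - 2 * x * t * s
  have haw : Integrable fun t => a t * (weight lam t : ℂ) := by
    have hw := continuous_weight hlam
    refine (integrable_continuous_mul_of_support hm ha hs
      (g := fun t : ℝ => (weight lam t : ℂ)) (by fun_prop)).congr (ae_of_all _ fun t => ?_)
    simp only
    ring
  have hprod : Integrable (Function.uncurry fun t s : ℝ =>
      a t * (weight lam t : ℂ) * (dunklDensity lam s : ℂ) * ((q t s ^ (-(lam + 1)) : ℝ) : ℂ))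
      (volume.prod (volume.restrict (Ioo (-1) 1))) := by
    refine Integrable.mul_bdd (c := (y ^ 2) ^ (-(lam + 1)))
      (haw.mul_prod (integrableOn_dunklDensity hlam).ofReal) ?_ ?_
    · refine Measurable.aestronglyMeasurable ?_
      simp only [q]
      fun_prop
    · have : ∀ᵐ z : ℝ × ℝ ∂(volume.prod (volume.restrict (Ioo (-1) 1))), z.2 ∈ Ioo (-1 : ℝ) 1 :=
        Measure.quasiMeasurePreserving_snd.ae (ae_restrict_mem measurableSet_Ioo)
      filter_upwards [this] with z hz
      have hz' : z.2 ∈ Icc (-1 : ℝ) 1 := ⟨hz.1.le, hz.2.le⟩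
      have hq := quadForm_pos (x := x) (t := z.1) hy hz'
      rw [Complex.norm_real, Real.norm_of_nonneg (by positivity)]
      refine Real.rpow_le_rpow_of_nonpos (by positivity) ?_ (by linarith)
      nlinarith [le_quadForm (y := y) (x := x) (t := z.1) hz', sq_nonneg (|x| - |z.1|)]
  have hswap := integral_integral_swap hprod
  have hL : ∫ t : ℝ, a t * (poissonDensity lam y x t : ℂ) * (weight lam t : ℂ) =
      ∫ s in Ioo (-1 : ℝ) 1, (dunklDensity lam s : ℂ) *
        ∫ t : ℝ, ((q t s ^ (-(lam + 1)) : ℝ) : ℂ) * (a t * (weight lam t : ℂ)) := by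
    trans ∫ t : ℝ, ∫ s in Ioo (-1 : ℝ) 1,
      a t * (weight lam t : ℂ) * (dunklDensity lam s : ℂ) * ((q t s ^ (-(lam + 1)) : ℝ) : ℂ)
    · refine integral_congr_ae (ae_of_all _ fun t => ?_)
      simp only
      rw [poissonDensity, ← integral_complex_ofReal, mul_right_comm, ← integral_const_mul]
      refine integral_congr_ae (ae_of_all _ fun s => ?_)
      simp only [q]
      push_cast
      ring
    · rw [hswap]
      refine integral_congr_ae (ae_of_all _ fun s => ?_)
      simp only
      rw [← integral_const_mul]
      refine integral_congr_ae (ae_of_all _ fun t => ?_)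
      simp only
      ring
  have hbound (s : ℝ) (hs1 : s ∈ Ioo (-1 : ℝ) 1) :
      ‖∫ t : ℝ, ((q t s ^ (-(lam + 1)) : ℝ) : ℂ) * (a t * (weight lam t : ℂ))‖ ≤
        C * (δ / |(|x| - |x₀|)|) ^ (N + 1) * q x₀ s ^ (-(lam + 1)) * M *
          intervalMass lam x₀ δ := by
    have hs2 : s ∈ Icc (-1 : ℝ) 1 := ⟨hs1.1.le, hs1.2.le⟩
    obtain ⟨p, hp, hpt⟩ := happ y x x₀ δ s hy hδ hD hs2
    have h0 := integral_polynomial_mul_eq_zero hlam hm ha hs hmom p (hp.trans hκ)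
    have hcont : Continuous fun t : ℝ => q t s ^ (-(lam + 1)) :=
      Continuous.rpow_const (by fun_prop) fun t => Or.inl (quadForm_pos hy hs2).ne'
    have hi1 : Integrable fun t : ℝ =>
        ((q t s ^ (-(lam + 1)) : ℝ) : ℂ) * (a t * (weight lam t : ℂ)) := by
      have hw := continuous_weight hlam
      refine (integrable_continuous_mul_of_support hm ha hs
        (g := fun t : ℝ => ((q t s ^ (-(lam + 1)) : ℝ) : ℂ) * (weight lam t : ℂ))
        (by fun_prop)).congr (ae_of_all _ fun t => ?_)
      simp only
      ring
    have hi2 : Integrable fun t : ℝ =>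
        ((p.eval t : ℝ) : ℂ) * (a t * (weight lam t : ℂ)) := by
      have hw := continuous_weight hlam
      have hp := p.continuous
      refine (integrable_continuous_mul_of_support hm ha hs
        (g := fun t : ℝ => ((p.eval t : ℝ) : ℂ) * (weight lam t : ℂ))
        (by fun_prop)).congr (ae_of_all _ fun t => ?_)
      simp only
      ring
    have h1 : ∫ t : ℝ, ((q t s ^ (-(lam + 1)) : ℝ) : ℂ) * (a t * (weight lam t : ℂ)) =
        ∫ t : ℝ, ((q t s ^ (-(lam + 1)) - p.eval t : ℝ) : ℂ) * (a t * (weight lam t : ℂ)) := by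
      rw [← sub_zero (∫ t : ℝ, ((q t s ^ (-(lam + 1)) : ℝ) : ℂ) * (a t * (weight lam t : ℂ))),
        ← h0, ← integral_sub hi1 hi2]
      refine integral_congr_ae (ae_of_all _ fun t => ?_)
      simp only
      push_cast
      ring
    rw [h1]
    exact norm_integral_mul_le_intervalMass hlam ha hs hpt
  rw [hL]
  have hK := integrableOn_dunklDensity_mul_rpow hlam hy x x₀
  refine (norm_integral_le_of_norm_le (hK.const_mul (C * (δ / |(|x| - |x₀|)|) ^ (N + 1) * M *
    intervalMass lam x₀ δ)) ?_).trans (le_of_eq ?_)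
  · filter_upwards [ae_restrict_mem measurableSet_Ioo] with s hs1
    have h1 := dunklDensity_pos (lam := lam) hs1
    rw [norm_mul, Complex.norm_real, Real.norm_of_nonneg h1.le]
    refine (mul_le_mul_of_nonneg_left (hbound s hs1) h1.le).trans (le_of_eq ?_)
    simp only [q]
    ring
  · rw [integral_const_mul, poissonDensity]

/-! ### Mass of an interval away from the origin -/

section IntervalMass

variable {lam x₀ δ : ℝ}

/-- The condition on `δ` keeps the interval away from the origin, so that the weight on it is
comparable to `|x₀|^(2 lam)`. -/
lemma abs_bounds_of_mem_ball (hδ : δ < |x₀ / 2|) {t : ℝ} (ht : t ∈ Metric.ball x₀ δ) :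
    |x₀| / 2 ≤ |t| ∧ |t| ≤ 3 / 2 * |x₀| := by
  rw [abs_div, abs_two] at hδ
  rw [Metric.mem_ball, Real.dist_eq] at ht
  have h1 := abs_sub_abs_le_abs_sub t x₀
  have h2 := abs_sub_abs_le_abs_sub x₀ t
  rw [abs_sub_comm] at h2
  constructor <;> linarith

lemma integrableOn_weight_ball (hlam : 0 < lam) :
    IntegrableOn (weight lam) (Metric.ball x₀ δ) :=
  ((continuous_weight hlam).locallyIntegrable (μ := volume)).integrableOn_isCompact
    (isCompact_closedBall x₀ δ) |>.mono_set Metric.ball_subset_closedBall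

lemma setIntegral_const_ball (hδ0 : 0 < δ) (c : ℝ) :
    ∫ _ in Metric.ball x₀ δ, c = 2 * δ * c := by
  rw [setIntegral_const, Measure.real, Real.volume_ball, ENNReal.toReal_ofReal (by positivity),
    smul_eq_mul]

lemma intervalMass_le (hlam : 0 < lam) (hδ0 : 0 < δ) (hδ : δ < |x₀ / 2|) :
    intervalMass lam x₀ δ ≤ 2 * δ * (3 / 2 * |x₀|) ^ (2 * lam) := by
  rw [← setIntegral_const_ball (x₀ := x₀) hδ0, intervalMass]
  refine setIntegral_mono_on (integrableOn_weight_ball hlam)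
    (integrableOn_const measure_ball_lt_top.ne) measurableSet_ball fun t ht => ?_
  exact Real.rpow_le_rpow (abs_nonneg _) (abs_bounds_of_mem_ball hδ ht).2 (by positivity)

lemma le_intervalMass (hlam : 0 < lam) (hδ0 : 0 < δ) (hδ : δ < |x₀ / 2|) :
    2 * δ * (|x₀| / 2) ^ (2 * lam) ≤ intervalMass lam x₀ δ := by
  rw [← setIntegral_const_ball (x₀ := x₀) hδ0, intervalMass]
  refine setIntegral_mono_on (integrableOn_const measure_ball_lt_top.ne)
    (integrableOn_weight_ball hlam) measurableSet_ball fun t ht => ?_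
  exact Real.rpow_le_rpow (by positivity) (abs_bounds_of_mem_ball hδ ht).1 (by positivity)

end IntervalMass

/-! ### Pointwise decay -/

/-- Pointwise decay of the Poisson integral of a function with vanishing moments. -/
lemma norm_integral_mul_poissonDensity_le_decay {lam : ℝ} (hlam : 0 < lam) (N : ℕ) :
    ∃ C : ℝ, 0 < C ∧ ∀ (a : ℝ → ℂ) (M x₀ δ : ℝ) (κ : ℕ), 2 * N ≤ κ → AEMeasurable a → 0 ≤ M →
      0 < δ → δ < |x₀ / 2| →
      (∀ᵐ t, ‖a t‖ ≤ M) → (∀ᵐ t, t ∉ Metric.ball x₀ δ → a t = 0) →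
      (∀ k : ℕ, k ≤ κ → ∫ t : ℝ, (t : ℂ) ^ k * a t * (weight lam t : ℂ) = 0) →
      ∀ y x : ℝ, 0 < y →
      ‖(y : ℂ) * ∫ t : ℝ, a t * (poissonDensity lam y x t : ℂ) * (weight lam t : ℂ)‖ ≤
        C * M * ((1 + |(|x| - |x₀|)| / δ) ^ (N + 2))⁻¹ *
          (|x₀| / (|x| + |x₀|)) ^ (2 * lam) := by
  obtain ⟨C₂, hC₂, hfar⟩ := norm_integral_mul_poissonDensity_le_of_moments hlam N
  set C₁ : ℝ := 2 ^ lam * 2 ^ lam / lam * (2 * Real.pi) with hC₁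
  set C₃ : ℝ := 2 ^ lam * 2 ^ lam / lam with hC₃
  have h1pos : 0 < C₁ := by positivity
  have h3pos : 0 < C₃ := by positivity
  refine ⟨C₁ * 5 ^ (N + 2) * 4 ^ (2 * lam) +
    C₂ * C₃ * 2 * (3 / 2) ^ (2 * lam) * (5 / 4) ^ (N + 2), by positivity,
    fun a M x₀ δ κ hκ hm hM hδ hδ2 ha hs hmom y x hy => ?_⟩
  have hX : 0 < |x₀| := by
    rw [abs_div, abs_two] at hδ2; linarith
  have hδ3 : δ < |x₀| / 2 := by rwa [abs_div, abs_two] at hδ2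
  set D := |(|x| - |x₀|)| with hD
  have hD0 : 0 ≤ D := abs_nonneg _
  have hxX : 0 < |x| + |x₀| := by positivity
  rw [mul_assoc, mul_assoc, add_mul]
  have hE : 0 ≤ M * (((1 + D / δ) ^ (N + 2))⁻¹ * (|x₀| / (|x| + |x₀|)) ^ (2 * lam)) := by
    positivity
  -- If `D < 4δ`, the sup bound suffices: `1 + D/δ ≤ 5`, and `|x| + |x₀| ≤ 4|x₀|` since `4δ <
  -- 2|x₀|`. These give the first constant; the second belongs to the far region.
  rcases lt_or_ge D (4 * δ) with hnear | hfar'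
  · refine le_trans ?_ (le_add_of_nonneg_right (mul_nonneg (by positivity) hE))
    refine (norm_integral_mul_poissonDensity_le hlam hM ha hy x).trans ?_
    have e1 : (5 ^ (N + 2) : ℝ)⁻¹ ≤ ((1 + D / δ) ^ (N + 2))⁻¹ := by
      gcongr
      have : D / δ ≤ 4 := by rw [div_le_iff₀ hδ]; exact hnear.le
      linarith
    have e2 : ((1 / 4 : ℝ)) ^ (2 * lam) ≤ (|x₀| / (|x| + |x₀|)) ^ (2 * lam) := by
      refine Real.rpow_le_rpow (by norm_num) ?_ (by positivity)
      rw [div_le_div_iff₀ (by norm_num) hxX]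
      have := (abs_le.1 (le_of_eq hD.symm)).2
      linarith
    have e3 : (4 : ℝ) ^ (2 * lam) * (1 / 4 : ℝ) ^ (2 * lam) = 1 := by
      rw [← Real.mul_rpow (by norm_num) (by norm_num)]; norm_num
    calc C₁ * M = C₁ * 5 ^ (N + 2) * 4 ^ (2 * lam) *
          (M * ((5 ^ (N + 2) : ℝ)⁻¹ * (1 / 4 : ℝ) ^ (2 * lam))) := by
          rw [show C₁ * 5 ^ (N + 2) * 4 ^ (2 * lam) *
            (M * ((5 ^ (N + 2) : ℝ)⁻¹ * (1 / 4 : ℝ) ^ (2 * lam))) =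
            C₁ * M * (5 ^ (N + 2) * (5 ^ (N + 2) : ℝ)⁻¹) *
              ((4 : ℝ) ^ (2 * lam) * (1 / 4 : ℝ) ^ (2 * lam)) by ring, e3,
            mul_inv_cancel₀ (by positivity)]
          ring
      _ ≤ _ := by gcongr
  · refine le_trans ?_ (le_add_of_nonneg_left (mul_nonneg (by positivity) hE))
    have hDpos : 0 < D := by linarith
    have h := hfar a M x₀ δ κ hκ hm hδ ha hs hmom y x hy hfar'
    have hW := intervalMass_le hlam hδ hδ2
    have hQ := poissonDensity_le_rpow hlam hy hxX
    have hQ0 := poissonDensity_nonneg (lam := lam) hy x x₀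
    -- This `D⁻¹`, with the factor `δ` from the mass of the interval, raises the exponent from `N +
    -- 1` to `N + 2`.
    have hyD : y * (y ^ 2 + (|x| - |x₀|) ^ 2)⁻¹ ≤ D⁻¹ := by
      rw [← sq_abs (|x| - |x₀|), ← hD, ← div_eq_mul_inv, div_le_iff₀ (by positivity),
        inv_mul_eq_div, le_div_iff₀ hDpos]
      nlinarith [sq_nonneg (y - D), sq_nonneg y, sq_nonneg D]
    have hyQ : y * poissonDensity lam y x x₀ ≤ C₃ * D⁻¹ * (|x| + |x₀|) ^ (-(2 * lam)) := by
      calc y * poissonDensity lam y x x₀ ≤ y * (C₃ * (y ^ 2 + (|x| - |x₀|) ^ 2)⁻¹ *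
            (|x| + |x₀|) ^ (-(2 * lam))) := by gcongr
        _ = C₃ * (y * (y ^ 2 + (|x| - |x₀|) ^ 2)⁻¹) * (|x| + |x₀|) ^ (-(2 * lam)) := by ring
        _ ≤ _ := by gcongr
    have hr : (δ / D) ^ (N + 2) ≤ (5 / 4) ^ (N + 2) * ((1 + D / δ) ^ (N + 2))⁻¹ := by
      rw [← div_eq_mul_inv, ← div_pow]
      refine pow_le_pow_left₀ (by positivity) ?_ _
      rw [div_le_div_iff₀ hDpos (by positivity), mul_add, mul_one, mul_div_cancel₀ _ hδ.ne']
      linarith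
    rw [norm_mul, Complex.norm_real, Real.norm_of_nonneg hy.le]
    calc y * ‖∫ t : ℝ, a t * (poissonDensity lam y x t : ℂ) * (weight lam t : ℂ)‖
        ≤ y * (C₂ * (δ / D) ^ (N + 1) * M * intervalMass lam x₀ δ *
            poissonDensity lam y x x₀) := by gcongr
      _ = C₂ * (δ / D) ^ (N + 1) * M * intervalMass lam x₀ δ *
            (y * poissonDensity lam y x x₀) := by ring
      _ ≤ C₂ * (δ / D) ^ (N + 1) * M * (2 * δ * (3 / 2 * |x₀|) ^ (2 * lam)) *
            (C₃ * D⁻¹ * (|x| + |x₀|) ^ (-(2 * lam))) := by gcongr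
      _ = C₂ * C₃ * 2 * (3 / 2) ^ (2 * lam) *
            (M * ((δ / D) ^ (N + 2) * (|x₀| / (|x| + |x₀|)) ^ (2 * lam))) := by
          rw [Real.mul_rpow (by norm_num) hX.le, Real.div_rpow hX.le hxX.le,
            Real.rpow_neg hxX.le, pow_succ (δ / D) (N + 1)]
          ring
      _ ≤ C₂ * C₃ * 2 * (3 / 2) ^ (2 * lam) *
            (M * ((5 / 4) ^ (N + 2) * ((1 + D / δ) ^ (N + 2))⁻¹ *
              (|x₀| / (|x| + |x₀|)) ^ (2 * lam))) := by gcongr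
      _ = _ := by ring

/-! ### Integrating the decay against the weight -/

lemma integrable_rpow_one_add_abs_div {σ : ℝ} (hσ : 1 < σ) {δ : ℝ} (hδ : 0 < δ) (c : ℝ) :
    Integrable fun x : ℝ => (1 + |x + c| / δ) ^ (-σ) := by
  have h : Integrable fun x : ℝ => (1 + ‖x‖) ^ (-σ) := integrable_one_add_norm (by simpa using hσ)
  refine ((h.comp_div hδ.ne').comp_add_right c).congr (ae_of_all _ fun x => ?_)
  simp only
  rw [Real.norm_eq_abs, abs_div, abs_of_pos hδ]

lemma integral_rpow_one_add_abs_div (σ : ℝ) {δ : ℝ} (hδ : 0 < δ) (c : ℝ) :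
    ∫ x : ℝ, (1 + |x + c| / δ) ^ (-σ) = δ * ∫ x : ℝ, (1 + |x|) ^ (-σ) := by
  rw [integral_add_right_eq_self (fun x : ℝ => (1 + |x| / δ) ^ (-σ)) c]
  have := Measure.integral_comp_div (fun x : ℝ => (1 + |x|) ^ (-σ)) δ
  simpa only [abs_div, abs_of_pos hδ, smul_eq_mul] using this

/-- The weight is absorbed by the decay of the Poisson integral away from `±x₀`. -/
lemma rpow_decay_mul_weight_le {lam p : ℝ} (hlam : 0 < lam) (hp1 : p ≤ 1) (N : ℕ)
    {x x₀ δ : ℝ} (hδ : 0 < δ) (hδ2 : δ < |x₀ / 2|) :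
    (((1 + |(|x| - |x₀|)| / δ) ^ (N + 2))⁻¹ * (|x₀| / (|x| + |x₀|)) ^ (2 * lam)) ^ p *
        weight lam x ≤
      2 ^ (2 * lam * (1 - p)) * |x₀| ^ (2 * lam) *
        ((1 + |x + -x₀| / δ) ^ (-((N + 2) * p - 2 * lam * (1 - p))) +
          (1 + |x + x₀| / δ) ^ (-((N + 2) * p - 2 * lam * (1 - p)))) := by
  have hδ3 : δ < |x₀| / 2 := by rwa [abs_div, abs_two] at hδ2
  have hX : 0 < |x₀| := by linarith
  have hxX : 0 < |x| + |x₀| := by positivity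
  set D := |(|x| - |x₀|)| with hD
  have hD0 : 0 ≤ D := abs_nonneg _
  set r := 1 + D / δ with hr
  have hr0 : 0 < r := by positivity
  set z := (|x| + |x₀|) / |x₀| with hz
  have hz0 : 0 < z := by positivity
  -- `|x| ≤ |x₀| + D` and `δ ≤ |x₀|`. This converts the leftover `z^(2 lam (1-p))` into a loss of `2
  -- lam (1-p)` in the exponent of `r`.
  have hzr : z ≤ 2 * r := by
    rw [hz, div_le_iff₀ hX, hr]
    have h1 : |x| - |x₀| ≤ D := le_abs_self _
    have h2 : D ≤ D / δ * |x₀| := by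
      rw [div_mul_eq_mul_div, le_div_iff₀ hδ]
      nlinarith
    nlinarith
  have hq : 0 ≤ 2 * lam * (1 - p) := mul_nonneg (by positivity) (by linarith)
  have hw : weight lam x ≤ |x₀| ^ (2 * lam) * z ^ (2 * lam) := by
    rw [← Real.mul_rpow hX.le hz0.le, hz, mul_div_cancel₀ _ hX.ne', weight]
    exact Real.rpow_le_rpow (abs_nonneg _) (by linarith) (by positivity)
  have hz1 : |x₀| / (|x| + |x₀|) = z⁻¹ := by rw [hz, inv_div]
  have hr1 : r ^ (-((N + 2) * p - 2 * lam * (1 - p))) ≤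
      (1 + |x + -x₀| / δ) ^ (-((N + 2) * p - 2 * lam * (1 - p))) +
          (1 + |x + x₀| / δ) ^ (-((N + 2) * p - 2 * lam * (1 - p))) := by
    have p1 : 0 ≤ (1 + |x + -x₀| / δ) ^ (-((N + 2) * p - 2 * lam * (1 - p))) := by positivity
    have p2 : 0 ≤ (1 + |x + x₀| / δ) ^ (-((N + 2) * p - 2 * lam * (1 - p))) := by positivity
    have : D = |x + -x₀| ∨ D = |x + x₀| := by
      rw [hD]
      rcases abs_choice x with hx | hx <;> rcases abs_choice x₀ with ht | ht <;> rw [hx, ht]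
      · left; rfl
      · right; rw [sub_neg_eq_add]
      · right; rw [← abs_neg]; congr 1; ring
      · left; rw [← abs_neg]; congr 1; ring
    rcases this with h | h <;> rw [hr, h] <;> linarith
  have hpow : ((r ^ (N + 2))⁻¹ * (z⁻¹) ^ (2 * lam)) ^ p =
      r ^ (-((N + 2) * p)) * z ^ (-(2 * lam * p)) := by
    rw [Real.mul_rpow (by positivity) (by positivity), ← Real.rpow_natCast, ← Real.rpow_neg hr0.le,
      ← Real.rpow_mul hr0.le, Real.inv_rpow hz0.le, ← Real.rpow_neg hz0.le, ← Real.rpow_mul hz0.le]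
    push_cast
    congr 2 <;> ring
  rw [hz1, hpow]
  calc r ^ (-((N + 2) * p)) * z ^ (-(2 * lam * p)) * weight lam x
      ≤ r ^ (-((N + 2) * p)) * z ^ (-(2 * lam * p)) * (|x₀| ^ (2 * lam) * z ^ (2 * lam)) := by
        gcongr
    _ = r ^ (-((N + 2) * p)) * |x₀| ^ (2 * lam) * z ^ (2 * lam * (1 - p)) := by
        rw [show 2 * lam * (1 - p) = -(2 * lam * p) + 2 * lam by ring, Real.rpow_add hz0]
        ring
    _ ≤ r ^ (-((N + 2) * p)) * |x₀| ^ (2 * lam) * (2 * r) ^ (2 * lam * (1 - p)) := by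
        gcongr
    _ = 2 ^ (2 * lam * (1 - p)) * |x₀| ^ (2 * lam) *
          r ^ (-((N + 2) * p - 2 * lam * (1 - p))) := by
        rw [Real.mul_rpow two_pos.le hr0.le, show -((N + 2) * p - 2 * lam * (1 - p)) =
          -((N + 2) * p) + 2 * lam * (1 - p) by ring, Real.rpow_add hr0]
        ring
    _ ≤ _ := by gcongr

lemma aestronglyMeasurable_poissonIntegral {lam : ℝ} (hlam : 0 < lam) {a : ℝ → ℂ}
    (hm : AEMeasurable a) {y : ℝ} (hy : 0 < y) :
    AEStronglyMeasurable (fun x => poissonIntegral lam a y x) := by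
  obtain ⟨K, -, h⟩ := poissonIntegral_eq hlam
  have hmk := hm.measurable_mk
  have h1 (x : ℝ) : poissonIntegral lam a y x = (K : ℂ) *
      ((y : ℂ) * ∫ t : ℝ, hm.mk a t * (poissonDensity lam y x t : ℂ) * (weight lam t : ℂ)) := by
    rw [h a y hy x]
    congr 2
    refine integral_congr_ae ?_
    filter_upwards [hm.ae_eq_mk] with t ht
    rw [ht]
  simp_rw [h1]
  have hQ := measurable_uncurry_poissonDensity lam y
  have hw := measurable_weight lam
  have h2 : StronglyMeasurable fun x : ℝ =>
      ∫ t : ℝ, hm.mk a t * (poissonDensity lam y x t : ℂ) * (weight lam t : ℂ) := by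
    refine StronglyMeasurable.integral_prod_right' (ν := volume) (f := fun z : ℝ × ℝ =>
      hm.mk a z.2 * (poissonDensity lam y z.1 z.2 : ℂ) * (weight lam z.2 : ℂ)) ?_
    refine Measurable.stronglyMeasurable ?_
    fun_prop
  exact ((h2.const_mul _).const_mul _).aestronglyMeasurable

lemma ae_norm_le_of_eLpNorm_top_le {a : ℝ → ℂ} {M : ℝ} (hM : 0 ≤ M)
    (h : eLpNorm a ⊤ volume ≤ ENNReal.ofReal M) : ∀ᵐ t, ‖a t‖ ≤ M := by
  rw [eLpNorm_exponent_top] at h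
  filter_upwards [ae_le_eLpNormEssSup (f := a) (μ := volume)] with t ht
  have := ht.trans h
  rw [← ofReal_norm, ENNReal.ofReal_le_ofReal_iff hM] at this
  exact this

end DunklHardy

theorem mainTheorem4 (lam p : ℝ) (hlam : 0 < lam)
    (hp : 2 * lam / (2 * lam + 1) < p) (hp1 : p ≤ 1) :
    ∃ C : ℝ, 0 < C ∧ ∀ (A : ℝ), 0 < A → ∀ (κ : ℕ) (a : ℝ → ℂ),
      DunklHardy.IsAtom lam p A κ a → ∀ y : ℝ, 0 < y →
        MeasureTheory.Integrable
          (fun x : ℝ => ‖DunklHardy.poissonIntegral lam a y x‖ ^ p * DunklHardy.weight lam x) ∧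
        ∫ x : ℝ, ‖DunklHardy.poissonIntegral lam a y x‖ ^ p * DunklHardy.weight lam x
          ≤ C * A ^ p := by
  open DunklHardy MeasureTheory in
  have hp0 : 0 < p := lt_trans (by positivity) hp
  set N : ℕ := ⌊(2 * lam + 1) * ((1 - p) / p)⌋₊ with hN
  have hNnonneg : 0 ≤ (2 * lam + 1) * ((1 - p) / p) :=
    mul_nonneg (by positivity) (div_nonneg (by linarith) hp0.le)
  set σ : ℝ := (N + 2) * p - 2 * lam * (1 - p) with hσdef
  -- `(N+1)p > (2 lam + 1)(1-p)`, hence `σ > p + (2 lam + 1)(1-p) - 2 lam (1-p) = 1`.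
  have hσ : 1 < σ := by
    have h1 := Nat.lt_floor_add_one ((2 * lam + 1) * ((1 - p) / p))
    rw [← hN, ← mul_div_assoc, div_lt_iff₀ hp0] at h1
    rw [hσdef]
    nlinarith
  obtain ⟨K, hK, hrep⟩ := poissonIntegral_eq hlam
  obtain ⟨C₀, hC₀, hdecay⟩ := norm_integral_mul_poissonDensity_le_decay hlam N
  set J : ℝ := ∫ x : ℝ, (1 + |x|) ^ (-σ) with hJ
  have hJ0 : 0 ≤ J := integral_nonneg fun x => by positivity
  -- The `+ 1` makes the constant positive knowing only `J ≥ 0`.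
  refine ⟨(K * C₀) ^ p * 2 ^ (2 * lam * (1 - p)) * 2 ^ (2 * lam) * J + 1, by positivity,
    fun A hA κ a hatom y hy => ?_⟩
  obtain ⟨hm, hκ, x₀, δ, hδ, hδ2, hbdd, hsupp, hmom⟩ := hatom
  have hκN : 2 * N ≤ κ := by
    have : ((N : ℕ) : ℤ) = ⌊(2 * lam + 1) * ((1 - p) / p)⌋ := by
      rw [hN]; exact Int.natCast_floor_eq_floor hNnonneg
    rw [← this] at hκ
    exact_mod_cast hκ
  have hX : 0 < |x₀| := by
    rw [abs_div, abs_two] at hδ2; linarith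
  set W := intervalMass lam x₀ δ with hW
  have hWle := le_intervalMass hlam hδ hδ2
  have hWpos : 0 < W := lt_of_lt_of_le (by positivity) hWle
  set M := A / W ^ (1 / p) with hM
  have hM0 : 0 ≤ M := by positivity
  have hMp : M ^ p = A ^ p / W := by
    rw [hM, Real.div_rpow hA.le (by positivity), ← Real.rpow_mul hWpos.le,
      one_div_mul_cancel hp0.ne', Real.rpow_one]
  have ha := ae_norm_le_of_eLpNorm_top_le hM0 hbdd
  let B : ℝ → ℝ := fun x => (K * C₀ * M) ^ p * (2 ^ (2 * lam * (1 - p)) * |x₀| ^ (2 * lam) *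
    ((1 + |x + -x₀| / δ) ^ (-σ) + (1 + |x + x₀| / δ) ^ (-σ)))
  have hpt (x : ℝ) : ‖poissonIntegral lam a y x‖ ^ p * weight lam x ≤ B x := by
    have h1 := hdecay a M x₀ δ κ hκN hm hM0 hδ hδ2 ha hsupp hmom y x hy
    have h2 := weight_nonneg lam x
    rw [hrep a y hy x, norm_mul, Complex.norm_real, Real.norm_of_nonneg hK.le]
    calc _ ≤ (K * (C₀ * M * ((1 + |(|x| - |x₀|)| / δ) ^ (N + 2))⁻¹ *
          (|x₀| / (|x| + |x₀|)) ^ (2 * lam))) ^ p * weight lam x := by gcongr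
      _ = (K * C₀ * M) ^ p * ((((1 + |(|x| - |x₀|)| / δ) ^ (N + 2))⁻¹ *
          (|x₀| / (|x| + |x₀|)) ^ (2 * lam)) ^ p * weight lam x) := by
        rw [← mul_assoc ((K * C₀ * M) ^ p), ← Real.mul_rpow (by positivity) (by positivity)]
        congr 2
        ring
      _ ≤ _ := mul_le_mul_of_nonneg_left (rpow_decay_mul_weight_le hlam hp1 N hδ hδ2)
        (by positivity)
  have hi1 := integrable_rpow_one_add_abs_div hσ hδ (-x₀)
  have hi2 := integrable_rpow_one_add_abs_div hσ hδ x₀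
  have hBi : Integrable B := ((hi1.add hi2).const_mul _).const_mul _
  have hBint : ∫ x, B x = (K * C₀ * M) ^ p * (2 ^ (2 * lam * (1 - p)) * |x₀| ^ (2 * lam) *
      (δ * J + δ * J)) := by
    simp only [B]
    rw [integral_const_mul, integral_const_mul, integral_add hi1 hi2,
      integral_rpow_one_add_abs_div σ hδ, integral_rpow_one_add_abs_div σ hδ]
  have hui : Integrable fun x : ℝ => ‖poissonIntegral lam a y x‖ ^ p * weight lam x := by
    refine hBi.mono' ?_ (ae_of_all _ fun x => ?_)
    · exact ((aestronglyMeasurable_poissonIntegral hlam hm hy).norm.aemeasurable.pow_const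
        p).aestronglyMeasurable.mul (measurable_weight lam).aestronglyMeasurable
    · rw [Real.norm_of_nonneg (mul_nonneg (by positivity) (weight_nonneg _ _))]
      exact hpt x
  refine ⟨hui, (integral_mono hui hBi hpt).trans ?_⟩
  rw [hBint, Real.mul_rpow (by positivity) hM0, hMp]
  -- The integrated majorant is at most a multiple of the mass `W`, which cancels the `W` in `M ^ p
  -- = A ^ p / W`.
  have hXW : |x₀| ^ (2 * lam) * (2 * δ) ≤ 2 ^ (2 * lam) * W := by
    calc |x₀| ^ (2 * lam) * (2 * δ) = 2 ^ (2 * lam) * (2 * δ * (|x₀| / 2) ^ (2 * lam)) := by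
          rw [Real.div_rpow hX.le two_pos.le]; field_simp
      _ ≤ _ := by gcongr
  calc (K * C₀) ^ p * (A ^ p / W) * (2 ^ (2 * lam * (1 - p)) * |x₀| ^ (2 * lam) *
        (δ * J + δ * J))
      = (K * C₀) ^ p * (A ^ p / W) * 2 ^ (2 * lam * (1 - p)) * J *
          (|x₀| ^ (2 * lam) * (2 * δ)) := by ring
    _ ≤ (K * C₀) ^ p * (A ^ p / W) * 2 ^ (2 * lam * (1 - p)) * J * (2 ^ (2 * lam) * W) := by
        gcongr
    _ = (K * C₀) ^ p * 2 ^ (2 * lam * (1 - p)) * 2 ^ (2 * lam) * J * A ^ p := by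
        field_simp
    _ ≤ _ := by
        have : 0 < A ^ p := by positivity
        nlinarith
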